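/- Let $\mathcal B$ be a unital $C^*$-algebra, let $E_+$ be a (right) Hilbert $\mathcal B$-module, and write $\mathcal B^a(E_+)$ for the $C^*$-algebra of adjointable operators on $E_+$. Let $\mathbb T$ be either $\mathbb R_+=[0,\infty)$ or $\mathbb N_0=\{0,1,2,\dots\}$. A correspondence over $\mathcal B$ is a Hilbert $\mathcal B$-module with a nondegenerate left action of $\mathcal B$ by adjointable operators, and $\odot$ denotes the internal tensor product. Let $\vartheta=(\vartheta_t)_{t\in\mathbb T}$ be a strict $E_0$-semigroup on $\mathcal B^a(E_+)$. That is, each $\vartheta_t$ is a unital $*$-endomorphism of $\mathcal B^a(E_+)$, $\vartheta_0=\mathrm{id}$, $\vartheta_{s+t}=\vartheta_s\circ\vartheta_t$, and for each $t$ the restriction of $\vartheta_t$ to the compact operators $\mathcal K(E_+)=\overline{\mathrm{span}}\{xy^*: x,y\in E_+\}$, where $xy^*\colon z\mapsto x\langle y,z\rangle$, acts nondegenerately on $E_+$. The product system of $\vartheta$ consists of $E_0=\mathcal B$ and, for $t>0$, the correspondences $E_t=E_+^*\odot_{\vartheta_t}E_+$. Here $E_+^*=\{x^*:x\in E_+\}$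 is the dual correspondence from $\mathcal B$ to $\mathcal B^a(E_+)$, with inner product $\langle x^*,y^*\rangle=xy^*$ and operations $bx^*a=(a^*xb^*)^*$, and the right factor is $E_+$ with left action of $\mathcal B^a(E_+)$ via $\vartheta_t$. We write $x^*\odot_t y$ for the elementary tensors of $E_t$. The product maps $u_{s,t}\colon E_s\odot E_t\to E_{s+t}$ are determined by $$u_{s,t}\bigl((x^*\odot_s x')\odot(y^*\odot_t y')\bigr)=x^*\odot_{s+t}\vartheta_t(x'y^*)y'\qquad(s,t>0),$$ and are the canonical identifications if $s=0$ or $t=0$. Suppose that $\vartheta$ is spatial, that is, its product system has a central unital unit: there are $\omega_t\in E_t$ ($t\in\mathbb T$) with $\omega_0=\mathbf 1$, $u_{s,t}(\omega_s\odot\omega_t)=\omega_{s+t}$, $b\omega_t=\omega_t b$ and $\langle\omega_t,\omega_t\rangle=\mathbf 1$ for all $s,t\in\mathbb T$ and $b\in\mathcal B$. Then there exist a correspondence $E_-$ over $\mathcal B$ and a semigroup $w=(w_t)_{t\in\mathbb T}$ of unitaries in $\mathcal B^a(E_+\odot E_-)$ (that is, $w_0=\mathrm{id}$ and $w_{s+t}=w_sw_t$)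 such that 1. the canonical homomorphism $a\mapsto a\odot\mathrm{id}_{E_-}$ from $\mathcal B^a(E_+)$ onto its image $\mathcal B^a(E_+)\odot\mathrm{id}_{E_-}\subset\mathcal B^a(E_+\odot E_-)$ is an isomorphism, and 2. for every $t\in\mathbb T$ the automorphism $\alpha_t=w_t\bullet w_t^*$ of $\mathcal B^a(E_+\odot E_-)$ restricts on $\mathcal B^a(E_+)\odot\mathrm{id}_{E_-}$ to $\vartheta_t\odot\mathrm{id}_{E_-}$, that is, $w_t(a\odot\mathrm{id}_{E_-})w_t^*=\vartheta_t(a)\odot\mathrm{id}_{E_-}$ for all $a\in\mathcal B^a(E_+)$. -/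

import Mathlib

open scoped TensorProduct

set_option linter.unusedSectionVars false

universe u v

noncomputable section

section RightInner

variable (B : Type*) [CStarAlgebra B] [PartialOrder B] [StarOrderedRing B]
variable {E : Type*} [NormedAddCommGroup E] [NormedSpace ℂ E] [Module Bᵐᵒᵖ E] [CStarModule Bᵐᵒᵖ E]

/-- The `B`-valued inner product `⟨x, y⟩` of a right Hilbert `B`-module `E`. A right Hilbert
`B`-module is encoded by Mathlib's `CStarModule` over the opposite algebra, so that `op b • x` is
`x b`, and `⟨x, y b⟩ = ⟨x, y⟩ b`. -/
def rinner (x y : E) : B := (inner Bᵐᵒᵖ x y).unop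

namespace rinner

variable {B}

theorem op_eq (x y : E) : MulOpposite.op (rinner B x y) = inner Bᵐᵒᵖ x y := rfl

theorem add_right (x y z : E) : rinner B x (y + z) = rinner B x y + rinner B x z := by
  simp [rinner]

theorem add_left (x y z : E) : rinner B (x + y) z = rinner B x z + rinner B y z := by
  simp [rinner]

theorem sub_right (x y z : E) : rinner B x (y - z) = rinner B x y - rinner B x z := by
  simp [rinner]

theorem smul_right (c : ℂ) (x y : E) : rinner B x (c • y) = c • rinner B x y := by
  simp [rinner]

theorem smul_left (c : ℂ) (x y : E) : rinner B (c • x) y = star c • rinner B x y := by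
  simp [rinner]

theorem op_smul_right (b : B) (x y : E) :
    rinner B x (MulOpposite.op b • y) = rinner B x y * b := by
  simp [rinner]

theorem op_smul_left (b : B) (x y : E) :
    rinner B (MulOpposite.op b • x) y = star b * rinner B x y := by
  simp [rinner]

theorem star_eq (x y : E) : star (rinner B x y) = rinner B y x := by
  rw [rinner, ← MulOpposite.unop_star, CStarModule.star_inner, rinner]

theorem self_nonneg (x : E) : 0 ≤ rinner B x x :=
  (CStarModule.inner_self_nonneg (A := Bᵐᵒᵖ) (x := x) :)

theorem self_eq_zero {x : E} : rinner B x x = 0 ↔ x = 0 := by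
  rw [rinner, MulOpposite.unop_eq_zero_iff, CStarModule.inner_self]

theorem zero_right (x : E) : rinner B x 0 = 0 := by simp [rinner]

theorem zero_left (x : E) : rinner B 0 x = 0 := by simp [rinner]

variable (B) in
theorem norm_sq (x : E) : ‖x‖ ^ 2 = ‖rinner B x x‖ := by
  rw [CStarModule.norm_sq_eq (A := Bᵐᵒᵖ)]; rfl

theorem norm_le (x y : E) : ‖rinner B x y‖ ≤ ‖x‖ * ‖y‖ :=
  CStarModule.norm_inner_le (A := Bᵐᵒᵖ) E

variable (B) in
theorem ext_right {x y : E} (h : ∀ z, rinner B z x = rinner B z y) : x = y := by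
  rw [← sub_eq_zero, ← self_eq_zero (B := B), sub_right, h, sub_self]

variable (B E) in
theorem continuous : Continuous fun p : E × E => rinner B p.1 p.2 :=
  MulOpposite.continuous_unop.comp (CStarModule.continuous_inner (A := Bᵐᵒᵖ))

theorem continuous_comp {X : Type*} [TopologicalSpace X] {f g : X → E} (hf : Continuous f)
    (hg : Continuous g) : Continuous fun x => rinner B (f x) (g x) :=
  (continuous B E).comp (hf.prodMk hg)

theorem sum_right {ι : Type*} (s : Finset ι) (x : E) (y : ι → E) :
    rinner B x (∑ i ∈ s, y i) = ∑ i ∈ s, rinner B x (y i) := by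
  classical
  induction s using Finset.induction_on with
  | empty => simp [zero_right]
  | insert a s h ih => rw [Finset.sum_insert h, Finset.sum_insert h, add_right, ih]

theorem sum_left {ι : Type*} (s : Finset ι) (x : E) (y : ι → E) :
    rinner B (∑ i ∈ s, y i) x = ∑ i ∈ s, rinner B (y i) x := by
  classical
  induction s using Finset.induction_on with
  | empty => simp [zero_left]
  | insert a s h ih => rw [Finset.sum_insert h, Finset.sum_insert h, add_left, ih]

end rinner

end RightInner

section Adjointable

variable (B : Type*) [CStarAlgebra B] [PartialOrder B] [StarOrderedRing B]
variable (E : Type*) [NormedAddCommGroup E] [NormedSpace ℂ E] [CompleteSpace E]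
  [Module Bᵐᵒᵖ E] [CStarModule Bᵐᵒᵖ E]

/-- The algebra of adjointable operators on the Hilbert `B`-module `E`, inside the bounded
operators. -/
def adjointableSubalgebra : Subalgebra ℂ (E →L[ℂ] E) where
  carrier := {a | ∃ a' : E →L[ℂ] E, ∀ x y, rinner B (a x) y = rinner B x (a' y)}
  mul_mem' := by
    rintro a b ⟨a', ha⟩ ⟨b', hb⟩
    exact ⟨b' * a', fun x y => by simp [ha, hb]⟩
  add_mem' := by
    rintro a b ⟨a', ha⟩ ⟨b', hb⟩
    exact ⟨a' + b', fun x y => by simp [ha, hb, rinner.add_left, rinner.add_right]⟩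
  algebraMap_mem' c := ⟨algebraMap ℂ _ (star c), fun x y => by
    simp [Algebra.algebraMap_eq_smul_one, rinner.smul_left, rinner.smul_right]⟩

/-- `𝓑ᵃ(E)`: the adjointable operators on the Hilbert `B`-module `E`, with the operator norm. -/
def Adj : Type _ := adjointableSubalgebra B E

variable {B E}

namespace Adj

instance : NormedRing (Adj B E) := inferInstanceAs (NormedRing (adjointableSubalgebra B E))

instance : NormedAlgebra ℂ (Adj B E) :=
  inferInstanceAs (NormedAlgebra ℂ (adjointableSubalgebra B E))

/-- The underlying bounded operator. -/
def toCLM (a : Adj B E) : E →L[ℂ] E := Subtype.val a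

theorem toCLM_injective : Function.Injective (toCLM : Adj B E → E →L[ℂ] E) :=
  Subtype.val_injective

instance : FunLike (Adj B E) E E where
  coe a := a.toCLM
  coe_injective _ _ h := toCLM_injective (DFunLike.coe_injective h)

instance : ContinuousSemilinearMapClass (Adj B E) (RingHom.id ℂ) E E where
  map_add a := map_add a.toCLM
  map_smulₛₗ a := map_smulₛₗ a.toCLM
  map_continuous a := a.toCLM.continuous

/-- An operator with an adjoint, as an element of `𝓑ᵃ(E)`. -/
def mk (a a' : E →L[ℂ] E) (h : ∀ x y, rinner B (a x) y = rinner B x (a' y)) : Adj B E :=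
  (⟨a, a', h⟩ : adjointableSubalgebra B E)

theorem mk_apply (a a' : E →L[ℂ] E) (h : ∀ x y, rinner B (a x) y = rinner B x (a' y)) (x : E) :
    mk a a' h x = a x := rfl

theorem ext' {a b : Adj B E} (h : ∀ x, a x = b x) : a = b := DFunLike.ext _ _ h

theorem mul_apply (a b : Adj B E) (x : E) : (a * b) x = a (b x) := rfl

theorem one_apply (x : E) : (1 : Adj B E) x = x := rfl

theorem zero_apply (x : E) : (0 : Adj B E) x = 0 := rfl

theorem add_apply (a b : Adj B E) (x : E) : (a + b) x = a x + b x := rfl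

theorem smul_apply (c : ℂ) (a : Adj B E) (x : E) : (c • a) x = c • a x := rfl

theorem norm_apply_le (a : Adj B E) (x : E) : ‖a x‖ ≤ ‖a‖ * ‖x‖ :=
  ContinuousLinearMap.le_opNorm a.toCLM _

theorem norm_le_of (a : Adj B E) {C : ℝ} (hC : 0 ≤ C) (h : ∀ x, ‖a x‖ ≤ C * ‖x‖) : ‖a‖ ≤ C :=
  ContinuousLinearMap.opNorm_le_bound a.toCLM hC h

/-- The adjoint operator. -/
instance : Star (Adj B E) where
  star a := mk a.2.choose a.toCLM fun x y => by
    rw [← rinner.star_eq]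
    exact (congrArg star (a.2.choose_spec y x).symm).trans (rinner.star_eq _ _)

theorem rinner_left (a : Adj B E) (x y : E) : rinner B (a x) y = rinner B x (star a y) :=
  a.2.choose_spec x y

theorem rinner_right (a : Adj B E) (x y : E) : rinner B x (a y) = rinner B (star a x) y := by
  rw [← rinner.star_eq, rinner_left, rinner.star_eq]

/-- The adjoint is the only operator satisfying the defining relation. -/
theorem star_eq_of (a b : Adj B E) (h : ∀ x y, rinner B (a x) y = rinner B x (b y)) :
    star a = b :=
  ext' fun y => rinner.ext_right B fun z => by rw [← rinner_left, h]

instance : StarRing (Adj B E) where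
  star_involutive a := star_eq_of _ _ fun x y => (rinner_right a x y).symm
  star_mul a b := star_eq_of _ _ fun x y => by
    rw [mul_apply, mul_apply, rinner_left, rinner_left]
  star_add a b := star_eq_of _ _ fun x y => by
    rw [add_apply, add_apply, rinner.add_left, rinner.add_right, rinner_left, rinner_left]

instance : StarModule ℂ (Adj B E) where
  star_smul c a := star_eq_of _ _ fun x y => by
    rw [smul_apply, smul_apply, rinner.smul_left, rinner.smul_right, rinner_left]

theorem norm_sq_le (a : Adj B E) : ‖a‖ ^ 2 ≤ ‖star a * a‖ := by
  have h : ‖a‖ ≤ √‖star a * a‖ := by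
    refine norm_le_of _ (Real.sqrt_nonneg _) fun x => ?_
    refine le_of_sq_le_sq ?_ (by positivity)
    rw [mul_pow, Real.sq_sqrt (norm_nonneg _), rinner.norm_sq B (a x), rinner_left]
    calc ‖rinner B x (star a (a x))‖ ≤ ‖x‖ * ‖(star a * a) x‖ := rinner.norm_le _ _
      _ ≤ ‖x‖ * (‖star a * a‖ * ‖x‖) := by
        gcongr; exact norm_apply_le _ _
      _ = _ := by ring
  calc ‖a‖ ^ 2 ≤ √‖star a * a‖ ^ 2 := by gcongr
    _ = _ := Real.sq_sqrt (norm_nonneg _)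

instance : CStarRing (Adj B E) where
  norm_mul_self_le a := by
    have := norm_sq_le a
    rwa [sq] at this

instance : CompleteSpace (Adj B E) := by
  have hiso : ∀ a : Adj B E, ‖star a‖ = ‖a‖ := norm_star
  have hcoe : Isometry (toCLM : Adj B E → E →L[ℂ] E) := isometry_subtype_coe
  refine Metric.complete_of_cauchySeq_tendsto fun u hu => ?_
  have hu' : CauchySeq fun n => star (u n) := by
    rw [Metric.cauchySeq_iff] at hu ⊢
    intro ε hε
    obtain ⟨N, hN⟩ := hu ε hε
    refine ⟨N, fun m hm n hn => ?_⟩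
    rw [dist_eq_norm, ← star_sub, hiso, ← dist_eq_norm]
    exact hN m hm n hn
  obtain ⟨a, ha⟩ := cauchySeq_tendsto_of_complete
    (u := fun n => (u n).toCLM) (hcoe.uniformContinuous.comp_cauchySeq hu)
  obtain ⟨a', ha'⟩ := cauchySeq_tendsto_of_complete
    (u := fun n => (star (u n)).toCLM) (hcoe.uniformContinuous.comp_cauchySeq hu')
  have key : ∀ x y, rinner B (a x) y = rinner B x (a' y) := by
    intro x y
    have e1 : Filter.Tendsto (fun n => u n x) Filter.atTop (nhds (a x)) :=
      ((ContinuousLinearMap.apply ℂ E x).continuous.tendsto a).comp ha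
    have e2 : Filter.Tendsto (fun n => star (u n) y) Filter.atTop (nhds (a' y)) :=
      ((ContinuousLinearMap.apply ℂ E y).continuous.tendsto a').comp ha'
    have f1 := ((rinner.continuous B E).tendsto (a x, y)).comp (e1.prodMk_nhds tendsto_const_nhds)
    have f2 := ((rinner.continuous B E).tendsto (x, a' y)).comp (tendsto_const_nhds.prodMk_nhds e2)
    refine tendsto_nhds_unique f1 (f2.congr fun n => ?_)
    exact (rinner_left (u n) x y).symm
  exact ⟨mk a a' key, hcoe.isUniformInducing.isInducing.tendsto_nhds_iff.2 ha⟩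

instance : CStarAlgebra (Adj B E) where

/-- The order of the C⋆-algebra `𝓑ᵃ(E)`. -/
instance : PartialOrder (Adj B E) := CStarAlgebra.spectralOrder _

instance : StarOrderedRing (Adj B E) := CStarAlgebra.spectralOrderedRing _

/-- Adjointable operators are automatically right `B`-linear. -/
theorem apply_op_smul (a : Adj B E) (b : B) (x : E) :
    a (MulOpposite.op b • x) = MulOpposite.op b • a x :=
  rinner.ext_right B fun z => by
    rw [rinner_right, rinner.op_smul_right, rinner.op_smul_right, rinner_right]

end Adj

end Adjointable

section Positivity

theorem exists_eq_star_mul_self {A : Type*} [CStarAlgebra A] [PartialOrder A] [StarOrderedRing A]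
    {h : A} (hh : 0 ≤ h) : ∃ s, h = star s * s :=
  CStarAlgebra.nonneg_iff_eq_star_mul_self.1 hh

theorem cstar_nonneg_of_conj {A : Type*} [CStarAlgebra A] [PartialOrder A] [StarOrderedRing A]
    {h : A} (hs : IsSelfAdjoint h)
    (key : ∀ c s : A, IsSelfAdjoint c → c * h * c = -(star s * s) → s = 0) : 0 ≤ h := by
  have h1 : h⁺ - h⁻ = h := CFC.posPart_sub_negPart h hs
  have h2 : h⁻ * h⁺ = 0 := CFC.negPart_mul_posPart h
  have hn : 0 ≤ h⁻ := CFC.negPart_nonneg h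
  have hns : IsSelfAdjoint h⁻ := hn.isSelfAdjoint
  have h3 : h⁻ * h * h⁻ = -(h⁻ * h⁻ * h⁻) := by
    have : h⁻ * h = -(h⁻ * h⁻) := by
      calc h⁻ * h = h⁻ * (h⁺ - h⁻) := by rw [h1]
        _ = _ := by rw [mul_sub, h2, zero_sub]
    rw [this, neg_mul]
  have h4 : 0 ≤ h⁻ * h⁻ * h⁻ := by
    have := conjugate_nonneg_of_nonneg hn hn
    exact this
  obtain ⟨s, hs'⟩ := exists_eq_star_mul_self h4
  have hs0 : s = 0 := key _ s hns (by rw [h3, hs'])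
  have h5 : h⁻ * h⁻ * h⁻ = 0 := by rw [hs', hs0]; simp
  have h6 : h⁻ = 0 := by
    have h7 : star (h⁻ * h⁻) * (h⁻ * h⁻) = 0 := by
      rw [star_mul, hns.star_eq, ← mul_assoc, h5, zero_mul]
    have h8 : star h⁻ * h⁻ = 0 := by
      rw [hns.star_eq]; exact CStarRing.star_mul_self_eq_zero_iff _ |>.1 h7
    exact CStarRing.star_mul_self_eq_zero_iff _ |>.1 h8
  rw [← h1, h6, sub_zero]
  exact CFC.posPart_nonneg h

/-- An adjointable operator `a = a*` with `⟨x, a x⟩ ≥ 0` for all `x` is positive. -/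
theorem Adj.nonneg_of {B : Type*} [CStarAlgebra B] [PartialOrder B] [StarOrderedRing B]
    {E : Type*} [NormedAddCommGroup E] [NormedSpace ℂ E] [CompleteSpace E]
    [Module Bᵐᵒᵖ E] [CStarModule Bᵐᵒᵖ E] {a : Adj B E} (hs : star a = a)
    (h : ∀ x, 0 ≤ rinner B x (a x)) : 0 ≤ a := by
  refine cstar_nonneg_of_conj hs fun c s hc hcs => Adj.ext' fun x => ?_
  have h1 := h (c x)
  rw [← hc.star_eq, ← Adj.rinner_right, hc.star_eq] at h1
  have h2 : c (a (c x)) = -(star s (s x)) := DFunLike.congr_fun hcs x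
  rw [Adj.zero_apply, ← rinner.self_eq_zero (B := B)]
  refine le_antisymm ?_ (rinner.self_nonneg _)
  rw [Adj.rinner_left]
  have h3 : rinner B x (-(star s (s x))) = -rinner B x (star s (s x)) := by
    simpa using rinner.smul_right (B := B) (-1 : ℂ) x (star s (s x))
  rw [h2, h3] at h1
  exact neg_nonneg.1 h1

/-- The Gram matrix of finitely many vectors of a Hilbert module is positive, hence of the form
`C* C`. -/
theorem exists_gram_eq {A : Type*} [CStarAlgebra A] [PartialOrder A] [StarOrderedRing A]
    {E : Type*} [NormedAddCommGroup E] [NormedSpace ℂ E] [Module Aᵐᵒᵖ E] [CStarModule Aᵐᵒᵖ E]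
    {n : Type*} [Fintype n] (x : n → E) :
    ∃ c : n → n → A, ∀ i j, rinner A (x i) (x j) = ∑ k, star (c k i) * c k j := by
  classical
  let _ : PartialOrder (CStarMatrix n n A) := CStarAlgebra.spectralOrder _
  have _ : StarOrderedRing (CStarMatrix n n A) := CStarAlgebra.spectralOrderedRing _
  let G : CStarMatrix n n A := CStarMatrix.ofMatrix fun i j => rinner A (x i) (x j)
  have hG : ∀ i j, G i j = rinner A (x i) (x j) := fun i j => rfl
  have hs : IsSelfAdjoint G := by
    refine CStarMatrix.ext fun i j => ?_
    rw [CStarMatrix.star_apply, hG, hG, rinner.star_eq]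
  have hpos : 0 ≤ G := by
    refine cstar_nonneg_of_conj hs fun c s hc hcs => ?_
    have hdiag : ∀ k, ∑ l, star (s l k) * s l k = 0 := by
      intro k
      refine le_antisymm ?_ (Finset.sum_nonneg fun l _ => star_mul_self_nonneg _)
      have h1 : (c * G * c) k k = rinner A (∑ i, MulOpposite.op (c i k) • x i)
          (∑ i, MulOpposite.op (c i k) • x i) := by
        rw [rinner.sum_right, CStarMatrix.mul_apply]
        refine Finset.sum_congr rfl fun j _ => ?_
        rw [rinner.op_smul_right, rinner.sum_left, CStarMatrix.mul_apply]
        congr 1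
        refine Finset.sum_congr rfl fun i _ => ?_
        rw [rinner.op_smul_left, hG, ← CStarMatrix.star_apply, hc.star_eq]
      have h2 : (c * G * c) k k = -∑ l, star (s l k) * s l k := by
        rw [hcs, CStarMatrix.neg_apply, CStarMatrix.mul_apply]
        rfl
      have h3 := rinner.self_nonneg (B := A) (∑ i, MulOpposite.op (c i k) • x i)
      rw [← h1, h2] at h3
      exact neg_nonneg.1 h3
    refine CStarMatrix.ext fun l k => ?_
    have := (Finset.sum_eq_zero_iff_of_nonneg fun l _ => star_mul_self_nonneg (s l k)).1
      (hdiag k) l (Finset.mem_univ _)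
    exact CStarRing.star_mul_self_eq_zero_iff _ |>.1 this
  obtain ⟨C, hC⟩ := exists_eq_star_mul_self hpos
  refine ⟨fun k i => C k i, fun i j => ?_⟩
  rw [← hG, hC, CStarMatrix.mul_apply]
  rfl

end Positivity

section Tensor

variable {A : Type*} [CStarAlgebra A] [PartialOrder A] [StarOrderedRing A]
variable {B : Type*} [CStarAlgebra B] [PartialOrder B] [StarOrderedRing B]
variable (E : Type*) [NormedAddCommGroup E] [NormedSpace ℂ E]
  [Module Aᵐᵒᵖ E] [CStarModule Aᵐᵒᵖ E]
variable {F : Type*} [NormedAddCommGroup F] [NormedSpace ℂ F] [CompleteSpace F]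
  [Module Bᵐᵒᵖ F] [CStarModule Bᵐᵒᵖ F]
variable (φ : A →⋆ₐ[ℂ] Adj B F)

/-- The algebraic tensor product of a right Hilbert `A`-module `E` and a correspondence `F` from
`A` to `B` with left action `φ`, equipped below with the semi-inner product
`⟨x ⊗ y, x' ⊗ y'⟩ = ⟨y, φ(⟨x, x'⟩) y'⟩`. -/
@[nolint unusedArguments]
def PreTensor (_φ : A →⋆ₐ[ℂ] Adj B F) : Type _ := E ⊗[ℂ] F

namespace PreTensor

instance : AddCommGroup (PreTensor E φ) := inferInstanceAs (AddCommGroup (E ⊗[ℂ] F))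

instance : Module ℂ (PreTensor E φ) := inferInstanceAs (Module ℂ (E ⊗[ℂ] F))

/-- The elementary tensors, as a bilinear map. -/
def mk : E →ₗ[ℂ] F →ₗ[ℂ] PreTensor E φ := TensorProduct.mk ℂ E F

/-- Linear maps out of the algebraic tensor product. -/
def lift {G : Type*} [AddCommGroup G] [Module ℂ G] (f : E →ₗ[ℂ] F →ₗ[ℂ] G) :
    PreTensor E φ →ₗ[ℂ] G := TensorProduct.lift f

variable {E φ}

theorem lift_mk {G : Type*} [AddCommGroup G] [Module ℂ G] (f : E →ₗ[ℂ] F →ₗ[ℂ] G) (x : E) (y : F) :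
    lift E φ f (mk E φ x y) = f x y := rfl

theorem exists_sum (p : PreTensor E φ) :
    ∃ s : Finset (E × F), p = ∑ i ∈ s, mk E φ i.1 i.2 := TensorProduct.exists_finset p

theorem induction {motive : PreTensor E φ → Prop} (p : PreTensor E φ)
    (tmul : ∀ x y, motive (mk E φ x y)) (add : ∀ p q, motive p → motive q → motive (p + q)) :
    motive p :=
  TensorProduct.induction_on p
    (by have := tmul 0 0; rwa [map_zero] at this) tmul add

variable (E φ)

/-- The functional `x' ⊗ y' ↦ ⟨y, φ(⟨x, x'⟩) y'⟩`. -/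
def formAux (x : E) (y : F) : PreTensor E φ →ₗ[ℂ] B :=
  lift E φ <| LinearMap.mk₂ ℂ (fun x' y' => rinner B y (φ (rinner A x x') y'))
    (fun _ _ _ => by rw [rinner.add_right, map_add, Adj.add_apply, rinner.add_right])
    (fun _ _ _ => by rw [rinner.smul_right, map_smul, Adj.smul_apply, rinner.smul_right])
    (fun _ _ _ => by rw [map_add, rinner.add_right])
    (fun _ _ _ => by rw [map_smul, rinner.smul_right])

theorem formAux_mk (x x' : E) (y y' : F) :
    formAux E φ x y (mk E φ x' y') = rinner B y (φ (rinner A x x') y') := rfl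

variable {E φ} in
theorem hom_ext {G : Type*} [AddCommGroup G] [Module ℂ G] {f g : PreTensor E φ →ₗ[ℂ] G}
    (h : ∀ x y, f (mk E φ x y) = g (mk E φ x y)) : f = g :=
  TensorProduct.ext' h

/-- The semi-inner product `⟨x ⊗ y, x' ⊗ y'⟩ = ⟨y, φ(⟨x, x'⟩) y'⟩`. -/
def form : PreTensor E φ →ₗ⋆[ℂ] PreTensor E φ →ₗ[ℂ] B :=
  (TensorProduct.lift (LinearMap.mk₂'ₛₗ (starRingEnd ℂ) (starRingEnd ℂ) (formAux E φ)
    (fun _ _ _ => hom_ext fun _ _ => by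
      simp only [formAux_mk, LinearMap.add_apply, rinner.add_left, map_add, Adj.add_apply,
        rinner.add_right])
    (fun _ _ _ => hom_ext fun _ _ => by
      simp only [formAux_mk, LinearMap.smul_apply, rinner.smul_left, map_smul, Adj.smul_apply,
        rinner.smul_right]
      rfl)
    (fun _ _ _ => hom_ext fun _ _ => by
      simp only [formAux_mk, LinearMap.add_apply, rinner.add_left])
    (fun _ _ _ => hom_ext fun _ _ => by
      simp only [formAux_mk, LinearMap.smul_apply, rinner.smul_left]
      rfl)) : E ⊗[ℂ] F →ₗ⋆[ℂ] PreTensor E φ →ₗ[ℂ] B)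

variable {E φ} in
theorem form_smul_left (c : ℂ) (p q : PreTensor E φ) :
    form E φ (c • p) q = star c • form E φ p q := by
  rw [LinearMap.map_smulₛₗ]; rfl

variable {E φ} in
theorem form_smul_right (c : ℂ) (p q : PreTensor E φ) :
    form E φ p (c • q) = c • form E φ p q := LinearMap.map_smul _ _ _

theorem form_mk (x x' : E) (y y' : F) :
    form E φ (mk E φ x y) (mk E φ x' y') = rinner B y (φ (rinner A x x') y') := rfl

/-- Right multiplication `x ⊗ y ↦ x ⊗ y b`. -/
instance : SMul Bᵐᵒᵖ (PreTensor E φ) where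
  smul b := lift E φ <| LinearMap.mk₂ ℂ (fun x y => mk E φ x (b • y))
    (fun _ _ _ => by rw [map_add, LinearMap.add_apply])
    (fun _ _ _ => by rw [LinearMap.map_smul, LinearMap.smul_apply])
    (fun _ _ _ => by rw [smul_add, map_add])
    (fun c x y => by
      rw [← LinearMap.map_smul]
      congr 1
      refine rinner.ext_right B fun z => ?_
      obtain ⟨b, rfl⟩ := MulOpposite.op_surjective b
      rw [rinner.op_smul_right, rinner.smul_right, rinner.smul_right, rinner.op_smul_right,
        smul_mul_assoc])

variable {E φ}

theorem smul_mk (b : Bᵐᵒᵖ) (x : E) (y : F) : b • mk E φ x y = mk E φ x (b • y) := rfl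

theorem op_smul_add (b : Bᵐᵒᵖ) (p q : PreTensor E φ) : b • (p + q) = b • p + b • q :=
  LinearMap.map_add _ p q

instance : Module Bᵐᵒᵖ (PreTensor E φ) where
  smul_zero b := LinearMap.map_zero _
  smul_add := op_smul_add
  one_smul p := by
    induction p using induction with
    | tmul x y => rw [smul_mk, one_smul]
    | add p q hp hq => rw [op_smul_add, hp, hq]
  mul_smul b c p := by
    induction p using induction with
    | tmul x y => rw [smul_mk, smul_mk, smul_mk, mul_smul]
    | add p q hp hq => rw [op_smul_add, hp, hq, op_smul_add, op_smul_add]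
  add_smul b c p := by
    induction p using induction with
    | tmul x y => rw [smul_mk, smul_mk, smul_mk, add_smul, map_add]
    | add p q hp hq => rw [op_smul_add, hp, hq, op_smul_add, op_smul_add]; abel
  zero_smul p := by
    induction p using induction with
    | tmul x y => rw [smul_mk, zero_smul, map_zero]
    | add p q hp hq => rw [op_smul_add, hp, hq, add_zero]

theorem form_op_smul_right (b : B) (p q : PreTensor E φ) :
    form E φ p (MulOpposite.op b • q) = form E φ p q * b := by
  induction q using induction with
  | add q q' hq hq' => rw [smul_add, map_add, map_add, hq, hq', add_mul]
  | tmul x' y' =>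
    induction p using induction with
    | add p p' hp hp' => rw [map_add, LinearMap.add_apply, LinearMap.add_apply, hp, hp', add_mul]
    | tmul x y =>
      rw [smul_mk, form_mk, form_mk, Adj.apply_op_smul, rinner.op_smul_right]

theorem star_form (p q : PreTensor E φ) : star (form E φ p q) = form E φ q p := by
  induction q using induction with
  | add q q' hq hq' => rw [map_add, map_add, star_add, hq, hq', LinearMap.add_apply]
  | tmul x' y' =>
    induction p using induction with
    | add p p' hp hp' => rw [map_add, LinearMap.add_apply, star_add, hp, hp', map_add]
    | tmul x y =>
      rw [form_mk, form_mk, rinner.star_eq, Adj.rinner_left, ← map_star, rinner.star_eq]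

theorem form_op_smul_left (b : B) (p q : PreTensor E φ) :
    form E φ (MulOpposite.op b • p) q = star b * form E φ p q := by
  rw [← star_form, form_op_smul_right, star_mul, star_form]

theorem form_self_nonneg (p : PreTensor E φ) : 0 ≤ form E φ p p := by
  obtain ⟨s, rfl⟩ := exists_sum p
  obtain ⟨c, hc⟩ := exists_gram_eq (A := A) (fun i : s => i.1.1)
  have h : ∑ i ∈ s, mk E φ i.1 i.2 = ∑ i : s, mk E φ i.1.1 i.1.2 :=
    (Finset.sum_coe_sort s fun i => mk E φ i.1 i.2).symm
  have key : form E φ (∑ i ∈ s, mk E φ i.1 i.2) (∑ i ∈ s, mk E φ i.1 i.2) =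
      ∑ k, rinner B (∑ i : s, φ (c k i) i.1.2) (∑ j : s, φ (c k j) j.1.2) := by
    rw [h]
    simp only [map_sum, LinearMap.sum_apply, form_mk, rinner.sum_left, rinner.sum_right]
    have : ∀ i j : s, rinner B i.1.2 (φ (rinner A i.1.1 j.1.1) j.1.2) =
        ∑ k, rinner B (φ (c k i) i.1.2) (φ (c k j) j.1.2) := by
      intro i j
      have e : φ (rinner A i.1.1 j.1.1) j.1.2 = ∑ k, star (φ (c k i)) (φ (c k j) j.1.2) := by
        have e1 : ∀ (t : Finset s) (f : s → Adj B F) (z : F), (∑ k ∈ t, f k) z = ∑ k ∈ t, f k z := by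
          intro t f z
          classical
          induction t using Finset.induction_on with
          | empty => rw [Finset.sum_empty, Finset.sum_empty, Adj.zero_apply]
          | insert a t ha ih =>
            rw [Finset.sum_insert ha, Finset.sum_insert ha, Adj.add_apply, ih]
        rw [hc, map_sum, e1]
        refine Finset.sum_congr rfl fun k _ => ?_
        rw [map_mul, map_star, Adj.mul_apply]
      rw [e, rinner.sum_right]
      refine Finset.sum_congr rfl fun k _ => ?_
      rw [Adj.rinner_left]
    simp only [this]
    rw [Finset.sum_comm_cycle]
  rw [key]
  exact Finset.sum_nonneg fun k _ => rinner.self_nonneg _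

theorem form_mul_form_le (p q : PreTensor E φ) {N : ℝ} (hN : 0 < N)
    (hp : ‖form E φ p p‖ ≤ N) : form E φ q p * form E φ p q ≤ N • form E φ q q := by
  set a := form E φ p q with ha
  have hqp : form E φ q p = star a := by rw [ha, star_form]
  have h0 := form_self_nonneg (MulOpposite.op a • p - (N : ℂ) • q)
  have h1 : form E φ (MulOpposite.op a • p - (N : ℂ) • q) (MulOpposite.op a • p - (N : ℂ) • q) =
      star a * form E φ p p * a - N • (star a * a) - N • (star a * a)
        + N • N • form E φ q q := by
    have hc : star (N : ℂ) = (N : ℂ) := Complex.conj_ofReal N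
    simp only [map_sub, LinearMap.sub_apply, form_op_smul_left, form_op_smul_right,
      form_smul_left, form_smul_right, hc, ← ha, hqp, smul_mul_assoc, mul_assoc]
    simp only [Complex.coe_smul]
    abel
  have h2 : star a * form E φ p p * a ≤ N • (star a * a) := by
    calc star a * form E φ p p * a ≤ ‖form E φ p p‖ • (star a * a) :=
          CStarAlgebra.star_left_conjugate_le_norm_smul
            (hb := (form_self_nonneg p).isSelfAdjoint)
      _ ≤ N • (star a * a) := smul_le_smul_of_nonneg_right hp (star_mul_self_nonneg a)
  rw [h1] at h0
  have h3 : N • (star a * a) ≤ N • N • form E φ q q := by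
    have := h0.trans (add_le_add_left (sub_le_sub_right (sub_le_sub_right h2 _) _) _)
    rw [sub_self, zero_sub, neg_add_eq_sub, sub_nonneg] at this
    exact this
  rw [hqp]
  exact (smul_le_smul_iff_of_pos_left hN).1 h3

theorem norm_form_sq_le (p q : PreTensor E φ) :
    ‖form E φ p q‖ ^ 2 ≤ ‖form E φ p p‖ * ‖form E φ q q‖ := by
  refine ge_of_tendsto (x := nhdsWithin ‖form E φ p p‖ (Set.Ioi ‖form E φ p p‖))
    (f := fun N : ℝ => N * ‖form E φ q q‖)
    (Filter.Tendsto.mono_left (Continuous.tendsto (by fun_prop) _) nhdsWithin_le_nhds) ?_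
  filter_upwards [self_mem_nhdsWithin] with N hN
  have hN0 : 0 < N := (norm_nonneg _).trans_lt hN
  calc ‖form E φ p q‖ ^ 2 = ‖form E φ q p * form E φ p q‖ := by
        rw [← star_form p q, CStarRing.norm_star_mul_self, sq]
    _ ≤ ‖N • form E φ q q‖ := by
        refine CStarAlgebra.norm_le_norm_of_nonneg_of_le ?_ (form_mul_form_le p q hN0 hN.le)
        rw [← star_form p q]
        exact star_mul_self_nonneg _
    _ = N * ‖form E φ q q‖ := by rw [norm_smul, Real.norm_of_nonneg hN0.le]

/-- The seminorm `‖⟨p, p⟩‖^{1/2}`. -/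
instance : SeminormedAddCommGroup (PreTensor E φ) :=
  AddGroupSeminorm.toSeminormedAddCommGroup
    { toFun := fun p => √‖form E φ p p‖
      map_zero' := by simp
      add_le' := fun p q => by
        refine Real.sqrt_le_left (by positivity) |>.2 ?_
        have h1 : ‖form E φ p q‖ ≤ √‖form E φ p p‖ * √‖form E φ q q‖ := by
          refine le_of_sq_le_sq ?_ (by positivity)
          rw [mul_pow, Real.sq_sqrt (norm_nonneg _), Real.sq_sqrt (norm_nonneg _)]
          exact norm_form_sq_le p q
        have h2 : ‖form E φ q p‖ ≤ √‖form E φ p p‖ * √‖form E φ q q‖ := by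
          rw [← star_form, norm_star]; exact h1
        have h3 : ‖form E φ (p + q) (p + q)‖ ≤
            ‖form E φ p p‖ + ‖form E φ q p‖ + (‖form E φ p q‖ + ‖form E φ q q‖) := by
          rw [map_add, map_add, LinearMap.add_apply, LinearMap.add_apply]
          exact (norm_add_le _ _).trans (add_le_add (norm_add_le _ _) (norm_add_le _ _))
        calc _ ≤ _ := h3
          _ ≤ √‖form E φ p p‖ ^ 2 + √‖form E φ p p‖ * √‖form E φ q q‖ +
              (√‖form E φ p p‖ * √‖form E φ q q‖ + √‖form E φ q q‖ ^ 2) := by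
            rw [Real.sq_sqrt (norm_nonneg _), Real.sq_sqrt (norm_nonneg _)]
            gcongr
          _ = _ := by ring
      neg' := fun p => by simp }

theorem norm_def (p : PreTensor E φ) : ‖p‖ = √‖form E φ p p‖ := rfl

theorem norm_sq (p : PreTensor E φ) : ‖p‖ ^ 2 = ‖form E φ p p‖ := Real.sq_sqrt (norm_nonneg _)

theorem norm_form_le (p q : PreTensor E φ) : ‖form E φ p q‖ ≤ ‖p‖ * ‖q‖ := by
  refine le_of_sq_le_sq ?_ (by positivity)
  rw [mul_pow, norm_sq, norm_sq]
  exact norm_form_sq_le p q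

instance : NormedSpace ℂ (PreTensor E φ) where
  norm_smul_le c p := by
    refine le_of_sq_le_sq ?_ (by positivity)
    rw [mul_pow, norm_sq, norm_sq, form_smul_left, form_smul_right, norm_smul, norm_smul,
      norm_star, ← mul_assoc, sq]

theorem norm_op_smul_le (b : Bᵐᵒᵖ) (p : PreTensor E φ) : ‖b • p‖ ≤ ‖b‖ * ‖p‖ := by
  obtain ⟨b, rfl⟩ := MulOpposite.op_surjective b
  refine le_of_sq_le_sq ?_ (by positivity)
  rw [mul_pow, norm_sq, norm_sq, form_op_smul_left, form_op_smul_right, MulOpposite.norm_op]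
  calc _ ≤ ‖star b‖ * (‖form E φ p p‖ * ‖b‖) :=
        (norm_mul_le _ _).trans (by gcongr; exact norm_mul_le _ _)
    _ = _ := by rw [norm_star]; ring

instance : UniformContinuousConstSMul Bᵐᵒᵖ (PreTensor E φ) where
  uniformContinuous_const_smul b :=
    (AddMonoidHomClass.lipschitz_of_bound (DistribSMul.toAddMonoidHom (PreTensor E φ) b) ‖b‖
      (norm_op_smul_le b)).uniformContinuous

instance : Inner Bᵐᵒᵖ (PreTensor E φ) where
  inner p q := MulOpposite.op (form E φ p q)

theorem continuous_form : Continuous fun z : PreTensor E φ × PreTensor E φ =>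
    form E φ z.1 z.2 := by
  let g : PreTensor E φ →L⋆[ℂ] PreTensor E φ →L[ℂ] B :=
    LinearMap.mkContinuous₂ (form E φ) 1 fun p q => by rw [one_mul]; exact norm_form_le p q
  have h : Continuous fun z : PreTensor E φ × PreTensor E φ => g z.1 z.2 := by fun_prop
  exact h

end PreTensor

end Tensor

section Tensor

variable {A : Type*} [CStarAlgebra A] [PartialOrder A] [StarOrderedRing A]
variable {B : Type*} [CStarAlgebra B] [PartialOrder B] [StarOrderedRing B]
variable (E : Type*) [NormedAddCommGroup E] [NormedSpace ℂ E]
  [Module Aᵐᵒᵖ E] [CStarModule Aᵐᵒᵖ E]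
variable {F : Type*} [NormedAddCommGroup F] [NormedSpace ℂ F] [CompleteSpace F]
  [Module Bᵐᵒᵖ F] [CStarModule Bᵐᵒᵖ F]
variable (φ : A →⋆ₐ[ℂ] Adj B F)

/-- The internal tensor product `E ⊙ F` over `A` of a Hilbert `A`-module `E` and a correspondence
`F` from `A` to `B` with left action `φ`: the Hilbert `B`-module obtained from the algebraic tensor
product by dividing out the null vectors of the semi-inner product
`⟨x ⊗ y, x' ⊗ y'⟩ = ⟨y, φ(⟨x, x'⟩) y'⟩` and completing. -/
def InternalTensor : Type _ := UniformSpace.Completion (PreTensor E φ)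

namespace InternalTensor

instance : NormedAddCommGroup (InternalTensor E φ) :=
  inferInstanceAs (NormedAddCommGroup (UniformSpace.Completion (PreTensor E φ)))

instance : NormedSpace ℂ (InternalTensor E φ) :=
  inferInstanceAs (NormedSpace ℂ (UniformSpace.Completion (PreTensor E φ)))

instance : CompleteSpace (InternalTensor E φ) :=
  inferInstanceAs (CompleteSpace (UniformSpace.Completion (PreTensor E φ)))

instance : Module Bᵐᵒᵖ (InternalTensor E φ) :=
  inferInstanceAs (Module Bᵐᵒᵖ (UniformSpace.Completion (PreTensor E φ)))

instance : UniformContinuousConstSMul Bᵐᵒᵖ (InternalTensor E φ) :=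
  inferInstanceAs (UniformContinuousConstSMul Bᵐᵒᵖ (UniformSpace.Completion (PreTensor E φ)))

/-- The inner product of `E ⊙ F`, by continuous extension. -/
instance : Inner Bᵐᵒᵖ (InternalTensor E φ) :=
  inferInstanceAs (Inner Bᵐᵒᵖ (UniformSpace.Completion (PreTensor E φ)))

/-- The canonical map of the algebraic tensor product into its separated completion. -/
def ofPre : PreTensor E φ →L[ℂ] InternalTensor E φ :=
  (UniformSpace.Completion.toComplL : PreTensor E φ →L[ℂ] UniformSpace.Completion (PreTensor E φ))

variable {E φ}

theorem norm_ofPre (p : PreTensor E φ) : ‖ofPre E φ p‖ = ‖p‖ := UniformSpace.Completion.norm_coe p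

theorem denseRange_ofPre : DenseRange (ofPre E φ) := UniformSpace.Completion.denseRange_coe

theorem op_smul_ofPre (b : Bᵐᵒᵖ) (p : PreTensor E φ) : b • ofPre E φ p = ofPre E φ (b • p) :=
  (UniformSpace.Completion.coe_smul b p).symm

theorem inner_ofPre (p q : PreTensor E φ) :
    inner Bᵐᵒᵖ (ofPre E φ p) (ofPre E φ q) = MulOpposite.op (PreTensor.form E φ p q) :=
  (UniformSpace.Completion.isDenseInducing_coe.prodMap
    UniformSpace.Completion.isDenseInducing_coe).extend_eq
    (f := Function.uncurry (inner Bᵐᵒᵖ : PreTensor E φ → PreTensor E φ → Bᵐᵒᵖ))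
    (MulOpposite.continuous_op.comp PreTensor.continuous_form) (p, q)

theorem continuous_inner :
    Continuous fun z : InternalTensor E φ × InternalTensor E φ => inner Bᵐᵒᵖ z.1 z.2 := by
  let inner' : PreTensor E φ →+ PreTensor E φ →+ Bᵐᵒᵖ :=
    { toFun := fun x => (MulOpposite.opAddEquiv.toAddMonoidHom).comp
        (PreTensor.form E φ x).toAddMonoidHom
      map_zero' := by ext; simp
      map_add' := fun x y => by ext z; simp }
  have h : Continuous fun p : PreTensor E φ × PreTensor E φ => inner' p.1 p.2 :=
    MulOpposite.continuous_op.comp PreTensor.continuous_form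
  exact (UniformSpace.Completion.isDenseInducing_toCompl (PreTensor E φ)).extend_Z_bilin
    (UniformSpace.Completion.isDenseInducing_toCompl (PreTensor E φ)) h

theorem induction {motive : InternalTensor E φ → Prop} (x : InternalTensor E φ)
    (hc : IsClosed {x | motive x}) (h : ∀ p, motive (ofPre E φ p)) : motive x :=
  UniformSpace.Completion.induction_on x hc h

theorem cinner {X : Type*} [TopologicalSpace X] {f g : X → InternalTensor E φ}
    (hf : Continuous f) (hg : Continuous g) : Continuous fun x => inner Bᵐᵒᵖ (f x) (g x) :=
  continuous_inner.comp (hf.prodMk hg)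

theorem norm_sq_eq (x : InternalTensor E φ) : ‖x‖ ^ 2 = ‖inner Bᵐᵒᵖ x x‖ := by
  induction x using induction with
  | hc => exact isClosed_eq (by fun_prop) (cinner continuous_id continuous_id).norm
  | h p => rw [norm_ofPre, inner_ofPre, PreTensor.norm_sq, MulOpposite.norm_op]

instance : CStarModule Bᵐᵒᵖ (InternalTensor E φ) where
  inner_add_right {x y z} := by
    induction x using induction with
    | hc =>
      exact isClosed_eq (cinner continuous_id continuous_const)
        ((cinner continuous_id continuous_const).add (cinner continuous_id continuous_const))
    | h x =>
      induction y using induction with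
      | hc =>
        exact isClosed_eq (cinner continuous_const (by fun_prop))
          ((cinner continuous_const continuous_id).add continuous_const)
      | h y =>
        induction z using induction with
        | hc =>
          exact isClosed_eq (cinner continuous_const (by fun_prop))
            (continuous_const.add (cinner continuous_const continuous_id))
        | h z =>
          rw [← map_add, inner_ofPre, inner_ofPre, inner_ofPre, map_add, MulOpposite.op_add]
  inner_self_nonneg {x} := by
    induction x using induction with
    | hc =>
      exact (isClosed_le continuous_const
        (MulOpposite.continuous_unop.comp (cinner continuous_id continuous_id)) :
          IsClosed {x : InternalTensor E φ | (0 : B) ≤ (inner Bᵐᵒᵖ x x).unop})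
    | h p => rw [inner_ofPre]; exact PreTensor.form_self_nonneg p
  inner_self {x} := by
    rw [← norm_eq_zero, ← norm_sq_eq, sq_eq_zero_iff, norm_eq_zero]
  inner_op_smul_right {b x y} := by
    obtain ⟨b, rfl⟩ := MulOpposite.op_surjective b
    induction x using induction with
    | hc =>
      exact isClosed_eq (cinner continuous_id continuous_const)
        (continuous_const.mul (cinner continuous_id continuous_const))
    | h x =>
      induction y using induction with
      | hc =>
        exact isClosed_eq (cinner continuous_const (continuous_const_smul _))
          (continuous_const.mul (cinner continuous_const continuous_id))
      | h y =>
        rw [op_smul_ofPre, inner_ofPre, inner_ofPre, PreTensor.form_op_smul_right,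
          MulOpposite.op_mul]
  inner_smul_right_complex {c x y} := by
    induction x using induction with
    | hc =>
      exact isClosed_eq (cinner continuous_id continuous_const)
        ((cinner continuous_id continuous_const).const_smul c)
    | h x =>
      induction y using induction with
      | hc =>
        exact isClosed_eq (cinner continuous_const (continuous_const_smul _))
          ((cinner continuous_const continuous_id).const_smul c)
      | h y =>
        rw [← map_smul, inner_ofPre, inner_ofPre, PreTensor.form_smul_right, MulOpposite.op_smul]
  star_inner x y := by
    induction x using induction with
    | hc =>
      exact isClosed_eq (cinner continuous_id continuous_const).star
        (cinner continuous_const continuous_id)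
    | h x =>
      induction y using induction with
      | hc =>
        exact isClosed_eq (cinner continuous_const continuous_id).star
          (cinner continuous_id continuous_const)
      | h y =>
        rw [inner_ofPre, inner_ofPre, ← MulOpposite.op_star, PreTensor.star_form]
  norm_eq_sqrt_norm_inner_self x := by
    rw [← norm_sq_eq, Real.sqrt_sq (norm_nonneg _)]

theorem rinner_ofPre (p q : PreTensor E φ) :
    rinner B (ofPre E φ p) (ofPre E φ q) = PreTensor.form E φ p q := by
  rw [rinner]
  exact congrArg MulOpposite.unop (inner_ofPre p q)

variable (E φ)

/-- The elementary tensor `x ⊙ y`. -/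
def tmul (x : E) (y : F) : InternalTensor E φ := ofPre E φ (PreTensor.mk E φ x y)

variable {E φ}

theorem rinner_tmul (x x' : E) (y y' : F) :
    rinner B (tmul E φ x y) (tmul E φ x' y') = rinner B y (φ (rinner A x x') y') := by
  rw [tmul, tmul, rinner_ofPre, PreTensor.form_mk]

theorem tmul_add_left (x x' : E) (y : F) :
    tmul E φ (x + x') y = tmul E φ x y + tmul E φ x' y := by
  rw [tmul, map_add, LinearMap.add_apply, map_add, tmul, tmul]

theorem tmul_add_right (x : E) (y y' : F) :
    tmul E φ x (y + y') = tmul E φ x y + tmul E φ x y' := by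
  rw [tmul, map_add, map_add, tmul, tmul]

theorem tmul_smul_left (c : ℂ) (x : E) (y : F) : tmul E φ (c • x) y = c • tmul E φ x y := by
  rw [tmul, map_smul, LinearMap.smul_apply, map_smul, tmul]

theorem tmul_smul_right (c : ℂ) (x : E) (y : F) : tmul E φ x (c • y) = c • tmul E φ x y := by
  rw [tmul, map_smul, map_smul, tmul]

theorem norm_tmul_le (x : E) (y : F) : ‖tmul E φ x y‖ ≤ ‖x‖ * ‖y‖ := by
  refine le_of_sq_le_sq ?_ (by positivity)
  rw [rinner.norm_sq B, rinner_tmul]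
  calc _ ≤ ‖y‖ * ‖φ (rinner A x x) y‖ := rinner.norm_le _ _
    _ ≤ ‖y‖ * (‖rinner A x x‖ * ‖y‖) := by
      gcongr
      exact (Adj.norm_apply_le _ _).trans
        (by gcongr; exact NonUnitalStarAlgHom.norm_apply_le φ _)
    _ = _ := by rw [← rinner.norm_sq]; ring

/-- Extension of a bounded linear map from the algebraic tensor product to `E ⊙ F`. -/
def extend {G : Type*} [NormedAddCommGroup G] [NormedSpace ℂ G] [CompleteSpace G]
    (f : PreTensor E φ →L[ℂ] G) : InternalTensor E φ →L[ℂ] G :=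
  (f.fromCompletion : UniformSpace.Completion (PreTensor E φ) →L[ℂ] G)

theorem extend_ofPre {G : Type*} [NormedAddCommGroup G] [NormedSpace ℂ G] [CompleteSpace G]
    (f : PreTensor E φ →L[ℂ] G) (p : PreTensor E φ) : extend f (ofPre E φ p) = f p :=
  ContinuousLinearMap.fromCompletion_apply_coe f p

theorem extend_tmul {G : Type*} [NormedAddCommGroup G] [NormedSpace ℂ G] [CompleteSpace G]
    (f : PreTensor E φ →L[ℂ] G) (x : E) (y : F) :
    extend f (tmul E φ x y) = f (PreTensor.mk E φ x y) := extend_ofPre f _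

theorem hom_ext {G : Type*} [NormedAddCommGroup G] [NormedSpace ℂ G]
    {f g : InternalTensor E φ →L[ℂ] G} (h : ∀ x y, f (tmul E φ x y) = g (tmul E φ x y)) :
    f = g := by
  refine ContinuousLinearMap.ext fun x => ?_
  induction x using induction with
  | hc => exact isClosed_eq f.continuous g.continuous
  | h p =>
    induction p using PreTensor.induction with
    | tmul x y => exact h x y
    | add p q hp hq => rw [map_add, map_add, map_add, hp, hq]

section Lift

variable {G : Type*} [NormedAddCommGroup G] [NormedSpace ℂ G] [CompleteSpace G]
  [Module Bᵐᵒᵖ G] [CStarModule Bᵐᵒᵖ G]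

theorem rinner_lift (f : E →ₗ[ℂ] F →ₗ[ℂ] G)
    (hf : ∀ x x' y y', rinner B (f x y) (f x' y') = rinner B y (φ (rinner A x x') y'))
    (p q : PreTensor E φ) :
    rinner B (PreTensor.lift E φ f p) (PreTensor.lift E φ f q) = PreTensor.form E φ p q := by
  induction p using PreTensor.induction with
  | add p p' hp hp' => rw [map_add, rinner.add_left, hp, hp', map_add, LinearMap.add_apply]
  | tmul x y =>
    induction q using PreTensor.induction with
    | add q q' hq hq' => rw [map_add, rinner.add_right, hq, hq', map_add]
    | tmul x' y' => rw [PreTensor.lift_mk, PreTensor.lift_mk, hf, PreTensor.form_mk]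

/-- A bilinear map with `⟨f x y, f x' y'⟩ = ⟨y, φ(⟨x, x'⟩) y'⟩` factors through `E ⊙ F`. -/
def lift (f : E →ₗ[ℂ] F →ₗ[ℂ] G)
    (hf : ∀ x x' y y', rinner B (f x y) (f x' y') = rinner B y (φ (rinner A x x') y')) :
    InternalTensor E φ →L[ℂ] G :=
  extend <| (PreTensor.lift E φ f).mkContinuous 1 fun p => by
    rw [one_mul]
    refine le_of_sq_le_sq ?_ (norm_nonneg _)
    rw [rinner.norm_sq B, rinner_lift f hf, PreTensor.norm_sq]

theorem lift_tmul (f : E →ₗ[ℂ] F →ₗ[ℂ] G)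
    (hf : ∀ x x' y y', rinner B (f x y) (f x' y') = rinner B y (φ (rinner A x x') y'))
    (x : E) (y : F) : lift f hf (tmul E φ x y) = f x y :=
  extend_tmul _ _ _

end Lift

variable [CompleteSpace E]

/-- `a ⊗ id` on the algebraic tensor product. -/
def ampPre (a : Adj A E) : PreTensor E φ →ₗ[ℂ] PreTensor E φ :=
  PreTensor.lift E φ ((PreTensor.mk E φ).comp (a.toCLM : E →ₗ[ℂ] E))

theorem ampPre_mk (a : Adj A E) (x : E) (y : F) :
    ampPre a (PreTensor.mk E φ x y) = PreTensor.mk E φ (a x) y := rfl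

theorem form_ampPre (a : Adj A E) (p q : PreTensor E φ) :
    PreTensor.form E φ (ampPre a p) q = PreTensor.form E φ p (ampPre (star a) q) := by
  induction p using PreTensor.induction with
  | add p p' hp hp' => simp only [map_add, LinearMap.add_apply, hp, hp']
  | tmul x y =>
    induction q using PreTensor.induction with
    | add q q' hq hq' => simp only [map_add, hq, hq']
    | tmul x' y' =>
      rw [ampPre_mk, ampPre_mk, PreTensor.form_mk, PreTensor.form_mk, Adj.rinner_left]

theorem norm_ampPre_le (a : Adj A E) (p : PreTensor E φ) : ‖ampPre a p‖ ≤ ‖a‖ * ‖p‖ := by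
  have h1 : star a * a ≤ algebraMap ℝ (Adj A E) (‖a‖ ^ 2) :=
    CStarAlgebra.star_mul_le_algebraMap_norm_sq
  obtain ⟨d, hd⟩ := exists_eq_star_mul_self (sub_nonneg.2 h1)
  have hlin : ampPre (φ := φ) (algebraMap ℝ (Adj A E) (‖a‖ ^ 2) - star a * a) p =
      ((‖a‖ ^ 2 : ℝ) : ℂ) • p - ampPre (star a) (ampPre a p) := by
    induction p using PreTensor.induction with
    | add p q hp hq => rw [map_add, hp, hq, smul_add, map_add, map_add]; abel
    | tmul x y =>
      rw [ampPre_mk, ampPre_mk, ampPre_mk, ← LinearMap.smul_apply, ← map_smul,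
        ← LinearMap.sub_apply, ← map_sub]
      congr 2
  clear h1
  have hlin2 : ampPre (φ := φ) (star d * d) p = ampPre (star d) (ampPre d p) := by
    clear hlin
    induction p using PreTensor.induction with
    | add p q hp hq => rw [map_add, hp, hq, map_add, map_add]
    | tmul x y => rw [ampPre_mk, ampPre_mk, ampPre_mk, Adj.mul_apply]
  have h2 : 0 ≤ PreTensor.form E φ p (ampPre (algebraMap ℝ (Adj A E) (‖a‖ ^ 2) - star a * a) p) := by
    rw [hd, hlin2, ← form_ampPre]
    exact PreTensor.form_self_nonneg _
  rw [hlin, map_sub, ← form_ampPre, sub_nonneg, PreTensor.form_smul_right] at h2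
  refine le_of_sq_le_sq ?_ (by positivity)
  rw [mul_pow, PreTensor.norm_sq, PreTensor.norm_sq]
  refine (CStarAlgebra.norm_le_norm_of_nonneg_of_le (PreTensor.form_self_nonneg _) h2).trans ?_
  rw [norm_smul, Complex.norm_real, Real.norm_of_nonneg (by positivity)]

/-- The bounded operator `a ⊙ id` on `E ⊙ F`. -/
def ampCLM (a : Adj A E) : InternalTensor E φ →L[ℂ] InternalTensor E φ :=
  extend ((ofPre E φ).comp ((ampPre a).mkContinuous ‖a‖ (norm_ampPre_le a)))

theorem ampCLM_tmul (a : Adj A E) (x : E) (y : F) :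
    ampCLM a (tmul E φ x y) = tmul E φ (a x) y :=
  extend_ofPre _ _

theorem ampCLM_ofPre (a : Adj A E) (p : PreTensor E φ) :
    ampCLM a (ofPre E φ p) = ofPre E φ (ampPre a p) :=
  extend_ofPre _ _

theorem rinner_of_dense (f g : InternalTensor E φ →L[ℂ] InternalTensor E φ)
    (h : ∀ p q, rinner B (f (ofPre E φ p)) (ofPre E φ q) = rinner B (ofPre E φ p) (g (ofPre E φ q)))
    (x y : InternalTensor E φ) : rinner B (f x) y = rinner B x (g y) := by
  induction x using induction with
  | hc =>
    exact isClosed_eq (rinner.continuous_comp f.continuous continuous_const)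
      (rinner.continuous_comp continuous_id continuous_const)
  | h p =>
    induction y using induction with
    | hc =>
      exact isClosed_eq (rinner.continuous_comp continuous_const continuous_id)
        (rinner.continuous_comp continuous_const g.continuous)
    | h q => exact h p q

theorem rinner_ampCLM (a : Adj A E) (x y : InternalTensor E φ) :
    rinner B (ampCLM a x) y = rinner B x (ampCLM (star a) y) :=
  rinner_of_dense _ _ (fun p q => by
    rw [ampCLM_ofPre, ampCLM_ofPre, rinner_ofPre, rinner_ofPre, form_ampPre]) x y

variable (E φ)

/-- The canonical unital homomorphism `a ↦ a ⊙ id_F` from `𝓑ᵃ(E)` to `𝓑ᵃ(E ⊙ F)`. -/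
def amplify : Adj A E →⋆ₐ[ℂ] Adj B (InternalTensor E φ) where
  toFun a := Adj.mk (ampCLM a) (ampCLM (star a)) (rinner_ampCLM a)
  map_one' := Adj.toCLM_injective <| hom_ext fun x y => ampCLM_tmul 1 x y
  map_mul' a b := Adj.toCLM_injective <| hom_ext fun x y => by
    change ampCLM (a * b) _ = ampCLM a (ampCLM b _)
    rw [ampCLM_tmul, ampCLM_tmul, ampCLM_tmul, Adj.mul_apply]
  map_zero' := Adj.toCLM_injective <| hom_ext fun x y => by
    change ampCLM 0 _ = 0
    rw [ampCLM_tmul, Adj.zero_apply, tmul, map_zero, LinearMap.zero_apply, map_zero]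
  map_add' a b := Adj.toCLM_injective <| hom_ext fun x y => by
    change ampCLM (a + b) _ = ampCLM a _ + ampCLM b _
    rw [ampCLM_tmul, ampCLM_tmul, ampCLM_tmul, Adj.add_apply, tmul, map_add,
      LinearMap.add_apply, map_add, tmul, tmul]
  commutes' c := Adj.toCLM_injective <| hom_ext fun x y => by
    change ampCLM (algebraMap ℂ (Adj A E) c) _ = (algebraMap ℂ (Adj B (InternalTensor E φ)) c) _
    rw [ampCLM_tmul, Algebra.algebraMap_eq_smul_one, Algebra.algebraMap_eq_smul_one,
      Adj.smul_apply, Adj.smul_apply, Adj.one_apply, Adj.one_apply, tmul, map_smul,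
      LinearMap.smul_apply, map_smul, tmul]
  map_star' a := (Adj.star_eq_of _ _ fun x y => rinner_ampCLM a x y).symm

theorem amplify_tmul (a : Adj A E) (x : E) (y : F) :
    amplify E φ a (tmul E φ x y) = tmul E φ (a x) y := ampCLM_tmul a x y

end InternalTensor

end Tensor

section Dual

variable (B : Type*) [CStarAlgebra B] [PartialOrder B] [StarOrderedRing B]
variable {E : Type*} [NormedAddCommGroup E] [NormedSpace ℂ E] [CompleteSpace E]
  [Module Bᵐᵒᵖ E] [CStarModule Bᵐᵒᵖ E]

theorem norm_op_smul_le' (b : B) (x : E) : ‖MulOpposite.op b • x‖ ≤ ‖b‖ * ‖x‖ := by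
  refine le_of_sq_le_sq ?_ (by positivity)
  rw [mul_pow, rinner.norm_sq B, rinner.norm_sq B x, rinner.op_smul_left, rinner.op_smul_right]
  calc _ ≤ ‖star b‖ * (‖rinner B x x‖ * ‖b‖) :=
        (norm_mul_le _ _).trans (by gcongr; exact norm_mul_le _ _)
    _ = _ := by rw [norm_star]; ring

theorem op_smul_smul (c : ℂ) (b : B) (x : E) :
    MulOpposite.op (c • b) • x = c • (MulOpposite.op b • x) :=
  rinner.ext_right B fun z => by
    rw [rinner.op_smul_right, rinner.smul_right, rinner.op_smul_right, mul_smul_comm]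

theorem op_smul_comm (c : ℂ) (b : B) (x : E) :
    MulOpposite.op b • (c • x) = c • (MulOpposite.op b • x) :=
  rinner.ext_right B fun z => by
    rw [rinner.op_smul_right, rinner.smul_right, rinner.smul_right, rinner.op_smul_right,
      smul_mul_assoc]

/-- The operator `z ↦ x ⟨y, z⟩`, as a bounded operator. -/
def rankOneCLM (x y : E) : E →L[ℂ] E :=
  LinearMap.mkContinuous
    { toFun := fun z => MulOpposite.op (rinner B y z) • x
      map_add' := fun z w => by rw [rinner.add_right, MulOpposite.op_add, add_smul]
      map_smul' := fun c z => by rw [rinner.smul_right, op_smul_smul, RingHom.id_apply] }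
    (‖x‖ * ‖y‖) fun z => by
      calc _ ≤ ‖rinner B y z‖ * ‖x‖ := norm_op_smul_le' B _ _
        _ ≤ (‖y‖ * ‖z‖) * ‖x‖ := by gcongr; exact rinner.norm_le _ _
        _ = _ := by ring

/-- The rank-one operator `x y* : z ↦ x ⟨y, z⟩`. -/
def rankOne (x y : E) : Adj B E :=
  Adj.mk (rankOneCLM B x y) (rankOneCLM B y x) fun z w => by
    change rinner B (MulOpposite.op (rinner B y z) • x) w =
      rinner B z (MulOpposite.op (rinner B x w) • y)
    rw [rinner.op_smul_left, rinner.op_smul_right, rinner.star_eq]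

variable {B}

theorem rankOne_apply (x y z : E) : rankOne B x y z = MulOpposite.op (rinner B y z) • x := rfl

theorem star_rankOne (x y : E) : star (rankOne B x y) = rankOne B y x :=
  Adj.star_eq_of _ _ fun z w => by
    rw [rankOne_apply, rankOne_apply, rinner.op_smul_left, rinner.op_smul_right, rinner.star_eq]

theorem rankOne_add_left (x x' y : E) :
    rankOne B (x + x') y = rankOne B x y + rankOne B x' y :=
  Adj.ext' fun z => by
    rw [Adj.add_apply, rankOne_apply, rankOne_apply, rankOne_apply, smul_add]

theorem rankOne_add_right (x y y' : E) :
    rankOne B x (y + y') = rankOne B x y + rankOne B x y' :=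
  Adj.ext' fun z => by
    rw [Adj.add_apply, rankOne_apply, rankOne_apply, rankOne_apply, rinner.add_left,
      MulOpposite.op_add, add_smul]

theorem rankOne_smul_left (c : ℂ) (x y : E) : rankOne B (c • x) y = c • rankOne B x y :=
  Adj.ext' fun z => by
    rw [Adj.smul_apply, rankOne_apply, rankOne_apply, op_smul_comm]

theorem rankOne_smul_right (c : ℂ) (x y : E) : rankOne B x (c • y) = star c • rankOne B x y :=
  Adj.ext' fun z => by
    rw [Adj.smul_apply, rankOne_apply, rankOne_apply, rinner.smul_left, op_smul_smul]

theorem mul_rankOne (a : Adj B E) (x y : E) : a * rankOne B x y = rankOne B (a x) y :=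
  Adj.ext' fun z => by
    rw [Adj.mul_apply, rankOne_apply, rankOne_apply, Adj.apply_op_smul]

theorem rankOne_mul (a : Adj B E) (x y : E) : rankOne B x y * a = rankOne B x (star a y) :=
  Adj.ext' fun z => by
    rw [Adj.mul_apply, rankOne_apply, rankOne_apply, ← Adj.rinner_right]

theorem rankOne_self_nonneg (x : E) : 0 ≤ rankOne B x x :=
  Adj.nonneg_of (star_rankOne x x) fun z => by
    rw [rankOne_apply, rinner.op_smul_right, ← rinner.star_eq x z]
    exact star_mul_self_nonneg _

theorem norm_rankOne_self (x : E) : ‖rankOne B x x‖ = ‖x‖ ^ 2 := by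
  refine le_antisymm ?_ ?_
  · rw [sq]
    refine Adj.norm_le_of _ (by positivity) fun z => ?_
    calc _ ≤ ‖rinner B x z‖ * ‖x‖ := norm_op_smul_le' B _ _
      _ ≤ (‖x‖ * ‖z‖) * ‖x‖ := by gcongr; exact rinner.norm_le _ _
      _ = _ := by ring
  · rcases eq_or_ne x 0 with rfl | hx
    · simp
    have h1 : ‖rinner B x (rankOne B x x x)‖ = ‖x‖ ^ 2 * ‖x‖ ^ 2 := by
      rw [rankOne_apply, rinner.op_smul_right, rinner.norm_sq B x]
      nth_rewrite 1 [← rinner.star_eq]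
      exact CStarRing.norm_star_mul_self
    have h2 : ‖rinner B x (rankOne B x x x)‖ ≤ ‖rankOne B x x‖ * ‖x‖ ^ 2 := by
      calc _ ≤ ‖x‖ * ‖rankOne B x x x‖ := rinner.norm_le _ _
        _ ≤ ‖x‖ * (‖rankOne B x x‖ * ‖x‖) := by gcongr; exact Adj.norm_apply_le _ _
        _ = _ := by ring
    rw [h1] at h2
    exact le_of_mul_le_mul_right h2 (by positivity)

variable (B E)

/-- The dual correspondence `E*` of `E` from `B` to `𝓑ᵃ(E)`: the elements are `x*` with `x ∈ E`,
the inner product is `⟨x*, y*⟩ = x y*`, and the bimodule operations are `b x* a = (a* x b*)*`. -/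
def DualModule (B : Type*) (E : Type*) [CStarAlgebra B] [PartialOrder B] [StarOrderedRing B]
    [NormedAddCommGroup E] [NormedSpace ℂ E] [CompleteSpace E] [Module Bᵐᵒᵖ E]
    [CStarModule Bᵐᵒᵖ E] : Type _ := E

namespace DualModule

instance : NormedAddCommGroup (DualModule B E) := inferInstanceAs (NormedAddCommGroup E)

instance : CompleteSpace (DualModule B E) := inferInstanceAs (CompleteSpace E)

variable {E}

/-- The element `x*` of the dual correspondence. -/
def of (x : E) : DualModule B E := x

variable {B}

/-- The vector `x` of the element `x*`. -/
def vec (x : DualModule B E) : E := x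

theorem vec_of (x : E) : vec (of B x) = x := rfl

theorem of_vec (x : DualModule B E) : of B (vec x) = x := rfl

theorem vec_injective : Function.Injective (vec : DualModule B E → E) := fun _ _ h => h

theorem vec_add (x y : DualModule B E) : vec (x + y) = vec x + vec y := rfl

theorem norm_vec (x : DualModule B E) : ‖vec x‖ = ‖x‖ := rfl

instance : Module ℂ (DualModule B E) where
  smul c x := of B (star c • vec x)
  one_smul x := by change star (1 : ℂ) • vec x = vec x; rw [star_one, one_smul]
  mul_smul c d x := by
    change star (c * d) • vec x = star c • star d • vec x
    rw [star_mul', mul_smul]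
  smul_zero c := by change star c • (0 : E) = 0; rw [smul_zero]
  smul_add c x y := by
    change star c • (vec x + vec y) = star c • vec x + star c • vec y; rw [smul_add]
  add_smul c d x := by
    change star (c + d) • vec x = star c • vec x + star d • vec x; rw [star_add, add_smul]
  zero_smul x := by change star (0 : ℂ) • vec x = 0; rw [star_zero, zero_smul]

theorem vec_smul (c : ℂ) (x : DualModule B E) : vec (c • x) = star c • vec x := rfl

instance : NormedSpace ℂ (DualModule B E) where
  norm_smul_le c x := by rw [← norm_vec, vec_smul, norm_smul, norm_star, norm_vec]

instance : Module (Adj B E)ᵐᵒᵖ (DualModule B E) where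
  smul a x := of B (star a.unop (vec x))
  one_smul x := by
    change star (1 : Adj B E) (vec x) = vec x
    rw [star_one, Adj.one_apply]
  mul_smul a b x := by
    change star (b.unop * a.unop) (vec x) = star a.unop (star b.unop (vec x))
    rw [star_mul, Adj.mul_apply]
  smul_zero a := map_zero (star a.unop)
  smul_add a x y := map_add (star a.unop) _ _
  add_smul a b x := by
    change star (a.unop + b.unop) (vec x) = star a.unop (vec x) + star b.unop (vec x)
    rw [star_add, Adj.add_apply]
  zero_smul x := by
    change star (0 : Adj B E) (vec x) = 0
    rw [star_zero, Adj.zero_apply]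

theorem vec_op_smul (a : Adj B E) (x : DualModule B E) :
    vec (MulOpposite.op a • x) = star a (vec x) := rfl

instance : CStarModule (Adj B E)ᵐᵒᵖ (DualModule B E) where
  inner x y := MulOpposite.op (rankOne B (vec x) (vec y))
  inner_add_right {x y z} := by
    rw [vec_add, rankOne_add_right, MulOpposite.op_add]
  inner_self_nonneg {x} := rankOne_self_nonneg (vec x)
  inner_self {x} := by
    rw [MulOpposite.op_eq_zero_iff, ← norm_eq_zero, norm_rankOne_self, norm_vec, sq_eq_zero_iff,
      norm_eq_zero]
  inner_op_smul_right {a x y} := by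
    obtain ⟨a, rfl⟩ := MulOpposite.op_surjective a
    rw [vec_op_smul, ← rankOne_mul, MulOpposite.op_mul]
  inner_smul_right_complex {c x y} := by
    rw [vec_smul, rankOne_smul_right, star_star, MulOpposite.op_smul]
  star_inner x y := by rw [← MulOpposite.op_star, star_rankOne]
  norm_eq_sqrt_norm_inner_self x := by
    rw [MulOpposite.norm_op, norm_rankOne_self, norm_vec, Real.sqrt_sq (norm_nonneg _)]

theorem rinner_def (x y : DualModule B E) :
    rinner (Adj B E) x y = rankOne B (vec x) (vec y) := rfl

/-- The operator `x* ↦ b x* = (x b*)*`. -/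
def leftCLM (b : B) : DualModule B E →L[ℂ] DualModule B E :=
  LinearMap.mkContinuous
    { toFun := fun x => of B (MulOpposite.op (star b) • vec x)
      map_add' := fun x y => by rw [vec_add, smul_add]; rfl
      map_smul' := fun c x => by rw [vec_smul, op_smul_comm]; rfl }
    ‖b‖ fun x => by
      rw [← norm_star b]
      exact norm_op_smul_le' B (star b) (vec x)

theorem vec_leftCLM (b : B) (x : DualModule B E) :
    vec (leftCLM b x) = MulOpposite.op (star b) • vec x := rfl

theorem rinner_leftCLM (b : B) (x y : DualModule B E) :
    rinner (Adj B E) (leftCLM b x) y = rinner (Adj B E) x (leftCLM (star b) y) := by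
  rw [rinner_def, rinner_def, vec_leftCLM, vec_leftCLM, star_star]
  refine Adj.ext' fun z => ?_
  rw [rankOne_apply, rankOne_apply, rinner.op_smul_left, MulOpposite.op_mul, mul_smul]

variable (B E)

/-- The left action of `B` on the dual correspondence `E*`, `b x* = (x b*)*`. -/
def left : B →⋆ₐ[ℂ] Adj (Adj B E) (DualModule B E) where
  toFun b := Adj.mk (leftCLM b) (leftCLM (star b)) (rinner_leftCLM b)
  map_one' := Adj.ext' fun x => by
    refine vec_injective ((vec_leftCLM 1 x).trans ?_)
    rw [star_one, MulOpposite.op_one, one_smul, Adj.one_apply]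
  map_mul' b c := Adj.ext' fun x => by
    refine vec_injective ((vec_leftCLM (b * c) x).trans ?_)
    rw [star_mul, MulOpposite.op_mul, mul_smul]; rfl
  map_zero' := Adj.ext' fun x => by
    refine vec_injective ((vec_leftCLM 0 x).trans ?_)
    rw [star_zero, MulOpposite.op_zero, zero_smul]; rfl
  map_add' b c := Adj.ext' fun x => by
    refine vec_injective ((vec_leftCLM (b + c) x).trans ?_)
    rw [star_add, MulOpposite.op_add, add_smul]; rfl
  commutes' c := Adj.ext' fun x => by
    refine vec_injective ((vec_leftCLM (algebraMap ℂ B c) x).trans ?_)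
    rw [Algebra.algebraMap_eq_smul_one, star_smul, star_one, op_smul_smul, MulOpposite.op_one,
      one_smul, Algebra.algebraMap_eq_smul_one]; rfl
  map_star' b := (Adj.star_eq_of _ _ fun x y => rinner_leftCLM b x y).symm

variable {B E}

theorem vec_left (b : B) (x : DualModule B E) :
    vec (left B E b x) = MulOpposite.op (star b) • vec x := rfl

end DualModule

end Dual

section ProductSystem

variable (T : Type*) [AddCommMonoid T]
variable (B : Type*) [CStarAlgebra B] [PartialOrder B] [StarOrderedRing B]
variable (E : Type*) [NormedAddCommGroup E] [NormedSpace ℂ E] [CompleteSpace E]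
  [Module Bᵐᵒᵖ E] [CStarModule Bᵐᵒᵖ E]

/-- An `E₀`-semigroup on `𝓑ᵃ(E)`: a semigroup of unital `*`-endomorphisms. -/
structure E0Semigroup where
  /-- The endomorphism at time `t`. -/
  hom : T → Adj B E →⋆ₐ[ℂ] Adj B E
  hom_zero : hom 0 = StarAlgHom.id ℂ (Adj B E)
  hom_add : ∀ s t, hom (s + t) = (hom s).comp (hom t)

/-- The compact operators `𝓚(E)`: the closed linear span of the rank-one operators. -/
def compactOperators : Submodule ℂ (Adj B E) :=
  (Submodule.span ℂ (Set.range fun z : E × E => rankOne B z.1 z.2)).topologicalClosure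

variable {T B E}

/-- An endomorphism `θ` of `𝓑ᵃ(E)` is strict if `θ(𝓚(E)) E` spans a dense subspace of `E`. -/
def IsStrict (θ : Adj B E →⋆ₐ[ℂ] Adj B E) : Prop :=
  Dense (Submodule.span ℂ {z : E | ∃ k ∈ compactOperators B E, ∃ x : E, z = θ k x} : Set E)

namespace E0Semigroup

variable (ϑ : E0Semigroup T B E)

theorem hom_add_apply (s t : T) (a : Adj B E) : ϑ.hom (s + t) a = ϑ.hom t (ϑ.hom s a) := by
  rw [add_comm, hom_add]; rfl

/-- The fibre `E_t = E* ⊙ E` of the product system of `ϑ` at `t > 0`, where `𝓑ᵃ(E)` acts on the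
right factor `E` via `ϑ_t`. -/
abbrev Fiber (t : T) : Type _ := InternalTensor (DualModule B E) (ϑ.hom t)

/-- The elementary tensor `x* ⊙_t y` in `E_t`. -/
def elem (t : T) (x y : E) : ϑ.Fiber t := InternalTensor.tmul _ (ϑ.hom t) (DualModule.of B x) y

/-- The left action of `B` on `E_t`, `b (x* ⊙_t y) = b x* ⊙_t y`. -/
def leftAction (t : T) : B →⋆ₐ[ℂ] Adj B (ϑ.Fiber t) :=
  (InternalTensor.amplify (DualModule B E) (ϑ.hom t)).comp (DualModule.left B E)

/-- The map `y* ⊗ z ↦ ϑ_t(x y*) z`. -/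
def actPre (t : T) (x : E) : PreTensor (DualModule B E) (ϑ.hom t) →ₗ[ℂ] E :=
  PreTensor.lift _ _ <| LinearMap.mk₂ ℂ (fun y z => ϑ.hom t (rankOne B x y.vec) z)
    (fun _ _ _ => by rw [DualModule.vec_add, rankOne_add_right, map_add, Adj.add_apply])
    (fun _ _ _ => by
      rw [DualModule.vec_smul, rankOne_smul_right, star_star, map_smul, Adj.smul_apply])
    (fun _ _ _ => map_add _ _ _)
    (fun _ _ _ => map_smul _ _ _)

theorem actPre_mk (t : T) (x : E) (y : DualModule B E) (z : E) :
    ϑ.actPre t x (PreTensor.mk _ _ y z) = ϑ.hom t (rankOne B x y.vec) z := rfl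

theorem rinner_actPre (t : T) (x x' : E) (p q : PreTensor (DualModule B E) (ϑ.hom t)) :
    rinner B (ϑ.actPre t x p) (ϑ.actPre t x' q) =
      PreTensor.form _ _ p (InternalTensor.ampPre (DualModule.left B E (rinner B x x')) q) := by
  induction p using PreTensor.induction with
  | add p p' hp hp' => rw [map_add, rinner.add_left, hp, hp', map_add, LinearMap.add_apply]
  | tmul y z =>
    induction q using PreTensor.induction with
    | add q q' hq hq' => rw [map_add, rinner.add_right, hq, hq', map_add, map_add]
    | tmul y' z' =>
      rw [actPre_mk, actPre_mk, InternalTensor.ampPre_mk, PreTensor.form_mk, Adj.rinner_left,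
        ← map_star, star_rankOne, ← Adj.mul_apply, ← map_mul, mul_rankOne, DualModule.rinner_def,
        DualModule.vec_left, rankOne_apply]
      congr 3
      refine Adj.ext' fun w => ?_
      rw [rankOne_apply, rankOne_apply, rinner.op_smul_left, star_star, MulOpposite.op_mul,
        mul_smul]

theorem norm_actPre_le (t : T) (x : E) (p : PreTensor (DualModule B E) (ϑ.hom t)) :
    ‖ϑ.actPre t x p‖ ≤ ‖x‖ * ‖p‖ := by
  refine le_of_sq_le_sq ?_ (by positivity)
  rw [rinner.norm_sq B, rinner_actPre]
  calc _ ≤ ‖p‖ * ‖InternalTensor.ampPre (DualModule.left B E (rinner B x x)) p‖ :=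
        PreTensor.norm_form_le _ _
    _ ≤ ‖p‖ * (‖rinner B x x‖ * ‖p‖) := by
      gcongr
      exact (InternalTensor.norm_ampPre_le _ _).trans
        (by gcongr; exact NonUnitalStarAlgHom.norm_apply_le (DualModule.left B E) _)
    _ = _ := by rw [← rinner.norm_sq]; ring

/-- The bounded operator `p ↦ u_t(x ⊙ p)` from `E_t` to `E`, with
`u_t(x ⊙ (y* ⊙_t z)) = ϑ_t(x y*) z`. -/
def act (t : T) : E →ₗ[ℂ] ϑ.Fiber t →L[ℂ] E where
  toFun x := InternalTensor.extend ((ϑ.actPre t x).mkContinuous ‖x‖ (ϑ.norm_actPre_le t x))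
  map_add' x x' := InternalTensor.hom_ext fun y z => by
    rw [add_apply, InternalTensor.extend_tmul, InternalTensor.extend_tmul,
      InternalTensor.extend_tmul]
    change ϑ.hom t (rankOne B (x + x') y.vec) z =
      ϑ.hom t (rankOne B x y.vec) z + ϑ.hom t (rankOne B x' y.vec) z
    rw [rankOne_add_left, map_add, Adj.add_apply]
  map_smul' c x := InternalTensor.hom_ext fun y z => by
    rw [smul_apply, InternalTensor.extend_tmul, InternalTensor.extend_tmul]
    change ϑ.hom t (rankOne B (c • x) y.vec) z = c • ϑ.hom t (rankOne B x y.vec) z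
    rw [rankOne_smul_left, map_smul, Adj.smul_apply]

theorem act_tmul (t : T) (x : E) (y : DualModule B E) (z : E) :
    ϑ.act t x (InternalTensor.tmul _ _ y z) = ϑ.hom t (rankOne B x y.vec) z :=
  InternalTensor.extend_tmul _ _ _

theorem act_elem (t : T) (x y z : E) :
    ϑ.act t x (ϑ.elem t y z) = ϑ.hom t (rankOne B x y) z :=
  ϑ.act_tmul t x (DualModule.of B y) z

theorem act_ofPre (t : T) (x : E) (p : PreTensor (DualModule B E) (ϑ.hom t)) :
    ϑ.act t x (InternalTensor.ofPre _ _ p) = ϑ.actPre t x p :=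
  InternalTensor.extend_ofPre _ _

theorem act_apply (t : T) (a : Adj B E) (x : E) (p : ϑ.Fiber t) :
    ϑ.act t (a x) p = ϑ.hom t a (ϑ.act t x p) := by
  have : ϑ.act t (a x) = (ϑ.hom t a).toCLM.comp (ϑ.act t x) :=
    InternalTensor.hom_ext fun y z => by
      refine (ϑ.act_tmul t (a x) y z).trans ?_
      refine Eq.trans ?_ (congrArg (ϑ.hom t a) (ϑ.act_tmul t x y z)).symm
      rw [← mul_rankOne, map_mul, Adj.mul_apply]
  rw [this]; rfl

theorem rinner_act (t : T) (x x' : E) (p q : ϑ.Fiber t) :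
    rinner B (ϑ.act t x p) (ϑ.act t x' q) =
      rinner B p (ϑ.leftAction t (rinner B x x') q) := by
  induction p using InternalTensor.induction with
  | hc =>
    exact isClosed_eq (rinner.continuous_comp (ϑ.act t x).continuous continuous_const)
      (rinner.continuous_comp continuous_id continuous_const)
  | h p =>
    induction q using InternalTensor.induction with
    | hc =>
      exact isClosed_eq (rinner.continuous_comp continuous_const (ϑ.act t x').continuous)
        (rinner.continuous_comp continuous_const
          (ϑ.leftAction t (rinner B x x')).toCLM.continuous)
    | h q =>
      rw [act_ofPre, act_ofPre, rinner_actPre, ← InternalTensor.rinner_ofPre]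
      exact congrArg _ (InternalTensor.ampCLM_ofPre _ q).symm

/-- The operator `y ↦ x* ⊙_t y` from `E` to `E_t`. -/
def creation (t : T) : DualModule B E →ₗ[ℂ] E →L[ℂ] ϑ.Fiber t where
  toFun x := LinearMap.mkContinuous
    { toFun := fun y => InternalTensor.tmul _ (ϑ.hom t) x y
      map_add' := InternalTensor.tmul_add_right x
      map_smul' := fun c y => InternalTensor.tmul_smul_right c x y }
    ‖x‖ (InternalTensor.norm_tmul_le x)
  map_add' x x' := ContinuousLinearMap.ext fun y => InternalTensor.tmul_add_left x x' y
  map_smul' c x := ContinuousLinearMap.ext fun y => InternalTensor.tmul_smul_left c x y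

theorem creation_apply (t : T) (x : DualModule B E) (y : E) :
    ϑ.creation t x y = InternalTensor.tmul _ _ x y := rfl

/-- The map `x* ⊗ x' ↦ (p ↦ x* ⊙_{s+t} u_t(x' ⊙ p))`. -/
def mulPre (s t : T) :
    PreTensor (DualModule B E) (ϑ.hom s) →ₗ[ℂ] ϑ.Fiber t →L[ℂ] ϑ.Fiber (s + t) :=
  PreTensor.lift _ _ <| LinearMap.mk₂ ℂ (fun x x' => (ϑ.creation (s + t) x).comp (ϑ.act t x'))
    (fun _ _ _ => by rw [map_add, ContinuousLinearMap.add_comp])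
    (fun _ _ _ => by rw [map_smul, ContinuousLinearMap.smul_comp])
    (fun _ _ _ => by rw [map_add, ContinuousLinearMap.comp_add])
    (fun _ _ _ => by rw [map_smul, ContinuousLinearMap.comp_smul])

theorem mulPre_mk (s t : T) (x : DualModule B E) (x' : E) (p : ϑ.Fiber t) :
    ϑ.mulPre s t (PreTensor.mk _ _ x x') p = InternalTensor.tmul _ _ x (ϑ.act t x' p) := rfl

theorem rinner_mulPre (s t : T) (v w : PreTensor (DualModule B E) (ϑ.hom s)) (p q : ϑ.Fiber t) :
    rinner B (ϑ.mulPre s t v p) (ϑ.mulPre s t w q) =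
      rinner B p (ϑ.leftAction t (PreTensor.form _ _ v w) q) := by
  induction v using PreTensor.induction with
  | add v v' hv hv' =>
    rw [map_add, add_apply, rinner.add_left, hv, hv', map_add,
      LinearMap.add_apply, map_add, Adj.add_apply, rinner.add_right]
  | tmul x x' =>
    induction w using PreTensor.induction with
    | add w w' hw hw' =>
      rw [map_add, add_apply, rinner.add_right, hw, hw', map_add,
        map_add, Adj.add_apply, rinner.add_right]
    | tmul y y' =>
      rw [mulPre_mk, mulPre_mk, InternalTensor.rinner_tmul, hom_add_apply, ← act_apply,
        rinner_act, PreTensor.form_mk]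

theorem norm_mulPre_le (s t : T) (w : PreTensor (DualModule B E) (ϑ.hom s)) :
    ‖ϑ.mulPre s t w‖ ≤ 1 * ‖w‖ := by
  rw [one_mul]
  refine ContinuousLinearMap.opNorm_le_bound _ (norm_nonneg _) fun p => ?_
  refine le_of_sq_le_sq ?_ (by positivity)
  rw [rinner.norm_sq B, rinner_mulPre]
  calc _ ≤ ‖p‖ * ‖ϑ.leftAction t (PreTensor.form _ _ w w) p‖ := rinner.norm_le _ _
    _ ≤ ‖p‖ * (‖PreTensor.form _ _ w w‖ * ‖p‖) := by
      gcongr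
      exact (Adj.norm_apply_le _ _).trans
        (by gcongr; exact NonUnitalStarAlgHom.norm_apply_le (ϑ.leftAction t) _)
    _ = _ := by rw [← PreTensor.norm_sq]; ring

/-- The multiplication `E_s × E_t → E_{s+t}` of the product system as a bounded bilinear map. -/
def mul (s t : T) : ϑ.Fiber s →L[ℂ] ϑ.Fiber t →L[ℂ] ϑ.Fiber (s + t) :=
  InternalTensor.extend ((ϑ.mulPre s t).mkContinuous 1 (ϑ.norm_mulPre_le s t))

theorem mul_ofPre (s t : T) (w : PreTensor (DualModule B E) (ϑ.hom s)) :
    ϑ.mul s t (InternalTensor.ofPre _ _ w) = ϑ.mulPre s t w :=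
  InternalTensor.extend_ofPre _ _

theorem rinner_mul (s t : T) (v w : ϑ.Fiber s) (p q : ϑ.Fiber t) :
    rinner B (ϑ.mul s t v p) (ϑ.mul s t w q) =
      rinner B p (ϑ.leftAction t (rinner B v w) q) := by
  have hL : Continuous fun b : B => ϑ.leftAction t b q := by
    have h1 : Continuous (ϑ.leftAction t) :=
      AddMonoidHomClass.continuous_of_bound (ϑ.leftAction t) 1 fun b => by
        rw [one_mul]; exact NonUnitalStarAlgHom.norm_apply_le (ϑ.leftAction t) b
    have h2 : Continuous (Adj.toCLM : Adj B (ϑ.Fiber t) → _) := continuous_subtype_val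
    exact (ContinuousLinearMap.apply ℂ _ q).continuous.comp (h2.comp h1)
  induction v using InternalTensor.induction with
  | hc =>
    exact isClosed_eq
      (rinner.continuous_comp ((ϑ.mul s t).continuous.clm_apply continuous_const) continuous_const)
      (rinner.continuous_comp continuous_const
        (hL.comp (rinner.continuous_comp continuous_id continuous_const)))
  | h v =>
    induction w using InternalTensor.induction with
    | hc =>
      exact isClosed_eq
        (rinner.continuous_comp continuous_const
          ((ϑ.mul s t).continuous.clm_apply continuous_const))
        (rinner.continuous_comp continuous_const
          (hL.comp (rinner.continuous_comp continuous_const continuous_id)))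
    | h w => rw [mul_ofPre, mul_ofPre, rinner_mulPre, InternalTensor.rinner_ofPre]

/-- The product maps `u_{s,t} : E_s ⊙ E_t → E_{s+t}` of the product system of `ϑ`. -/
def productMap (s t : T) : InternalTensor (ϑ.Fiber s) (ϑ.leftAction t) →L[ℂ] ϑ.Fiber (s + t) :=
  InternalTensor.lift
    (LinearMap.mk₂ ℂ (fun v p => ϑ.mul s t v p)
      (fun _ _ _ => by rw [map_add, add_apply])
      (fun _ _ _ => by rw [map_smul, smul_apply])
      (fun _ _ _ => map_add _ _ _)
      (fun _ _ _ => map_smul _ _ _))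
    (fun v w p q => ϑ.rinner_mul s t v w p q)

/-- The formula that determines `u_{s,t}`. -/
theorem productMap_elem (s t : T) (x x' y y' : E) :
    ϑ.productMap s t
        (InternalTensor.tmul (ϑ.Fiber s) (ϑ.leftAction t) (ϑ.elem s x x') (ϑ.elem t y y')) =
      ϑ.elem (s + t) x (ϑ.hom t (rankOne B x' y) y') := by
  refine (InternalTensor.lift_tmul _ _ _ _).trans ?_
  change ϑ.mul s t (ϑ.elem s x x') (ϑ.elem t y y') = _
  rw [← act_elem]
  exact congrArg (fun f => f (ϑ.elem t y y'))
    (ϑ.mul_ofPre s t (PreTensor.mk _ _ (DualModule.of B x) x'))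

end E0Semigroup

end ProductSystem

section Spatial

namespace E0Semigroup

variable {T : AddSubmonoid ℝ}
variable {B : Type*} [CStarAlgebra B] [PartialOrder B] [StarOrderedRing B]
variable {E : Type*} [NormedAddCommGroup E] [NormedSpace ℂ E] [CompleteSpace E]
  [Module Bᵐᵒᵖ E] [CStarModule Bᵐᵒᵖ E]
variable (ϑ : E0Semigroup T B E)

/-- A central unital unit of the product system of `ϑ`. The product system has `E_0 = B` with the
canonical identifications `B ⊙ E_t = E_t = E_t ⊙ B`, and a unit has the value `1 ∈ B` at time `0`,
so the conditions that involve time `0` hold automatically; the data are the `ω_t ∈ E_t` with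
`t > 0`. -/
structure CentralUnitalUnit where
  /-- The vector `ω_t ∈ E_t`. -/
  vec : ∀ t : T, 0 < t → ϑ.Fiber t
  /-- `u_{s,t}(ω_s ⊙ ω_t) = ω_{s+t}`. -/
  unit : ∀ (s t : T) (hs : 0 < s) (ht : 0 < t),
    ϑ.productMap s t (InternalTensor.tmul (ϑ.Fiber s) (ϑ.leftAction t) (vec s hs) (vec t ht)) =
      vec (s + t) (add_pos hs ht)
  /-- `b ω_t = ω_t b`. -/
  central : ∀ (t : T) (ht : 0 < t) (b : B),
    ϑ.leftAction t b (vec t ht) = MulOpposite.op b • vec t ht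
  /-- `⟨ω_t, ω_t⟩ = 1`. -/
  unital : ∀ (t : T) (ht : 0 < t), rinner B (vec t ht) (vec t ht) = 1

/-- `ϑ` is spatial if its product system has a central unital unit. -/
def IsSpatial : Prop := Nonempty ϑ.CentralUnitalUnit

end E0Semigroup

end Spatial

section Correspondences

/-- A correspondence over the unital C⋆-algebra `B`: a Hilbert `B`-module with a nondegenerate left
action of `B` by adjointable operators. As `B` is unital, nondegenerate means that `1` acts as the
identity, that is, the action is a unital `*`-homomorphism `B → 𝓑ᵃ(F)`. -/
structure Correspondence (B : Type u) [CStarAlgebra B] [PartialOrder B] [StarOrderedRing B] where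
  /-- The underlying Hilbert module. -/
  carrier : Type v
  [normedAddCommGroup : NormedAddCommGroup carrier]
  [normedSpace : NormedSpace ℂ carrier]
  [completeSpace : CompleteSpace carrier]
  [module : Module Bᵐᵒᵖ carrier]
  [cstarModule : CStarModule Bᵐᵒᵖ carrier]
  /-- The left action of `B`. -/
  left : B →⋆ₐ[ℂ] Adj B carrier

attribute [instance] Correspondence.normedAddCommGroup Correspondence.normedSpace
  Correspondence.completeSpace Correspondence.module Correspondence.cstarModule

end Correspondences

end

/-! The product system acts on `E` from the right: `x · (y* ⊙_t z) = ϑ_t(x y*) z`. This action is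
associative, satisfies `(a x) · p = ϑ_t(a)(x · p)` for adjointable `a`, and, by strictness, the
vectors `x · p` with `p ∈ E_t` span a dense subspace of `E`. So `E ⊙ E_t ≅ E`, and under this
identification `a ⊙ id` becomes `ϑ_t(a)`.

It remains to find a correspondence `E_-` that absorbs every `E_t` from the left, `E_t ⊙ E_- ≅ E_-`.
A central unital unit provides one: the maps `p ↦ p ω_r` from `E_s` to `E_{s+r}` are isometric and
`B`-bilinear, because `⟨p ω, q ω⟩ = ⟨ω, ⟨p, q⟩ ω⟩ = ⟨ω, ω⟩ ⟨p, q⟩ = ⟨p, q⟩`, and they form an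
inductive system because `ω_r ω_d = ω_{r+d}`. Its limit is `E_-`. Multiplication from the left by
`E_t` commutes with these embeddings, and it fills the limit because `p ∈ E_s` has the same image as
`p ω_t ∈ E_{s+t} = E_{t+s}`, which is a limit of sums of products from `E_t` and `E_s`.

Hence `E ⊙ E_- ≅ E ⊙ (E_t ⊙ E_-) ≅ (E ⊙ E_t) ⊙ E_- ≅ E ⊙ E_-`, and this composition is the unitary
`w_t : x ⊙ p ξ ↦ x p ⊙ ξ`. The semigroup law is associativity, and the relation `w_t (a ⊙ id) =
(ϑ_t(a) ⊙ id) w_t` is `(a x) p = ϑ_t(a)(x p)`. The amplification is faithful since the image `Ω` of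
`ω_t` in `E_-` satisfies `⟨Ω, b Ω⟩ = b`.

None of these identifications is built as a map between tensor products. The vectors `x ⊙ p q` and
`x p ⊙ q`, with `p ∈ E_t`, `q ∈ E_r` and `r > 0`, are two total families in `E ⊙ E_-`;
`rinner_tmul_incl_mulTo` shows that they have equal inner products, and `exists_unitary_of_gram_eq`
turns this into a unitary. Totality is `mem_of_tmul_incl_mulTo` and `mem_of_tmul_act_incl`, which
rest on `dense_span_act` and `dense_span_mulTo`. -/

noncomputable section

/-! ### Density arguments in internal tensor products -/

section DenseSpan

/-- A continuous linear map that sends a set with dense span into a closed subspace has its whole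
range in that subspace. -/
theorem ContinuousLinearMap.mem_of_dense_span {H K : Type*} [NormedAddCommGroup H]
    [NormedSpace ℂ H] [NormedAddCommGroup K] [NormedSpace ℂ K] (g : H →L[ℂ] K) {s : Set H}
    (hs : Dense (Submodule.span ℂ s : Set H)) {M : Submodule ℂ K} (hM : IsClosed (M : Set K))
    (h : ∀ y ∈ s, g y ∈ M) (y : H) : g y ∈ M := by
  have h1 : Submodule.span ℂ s ≤ M.comap (g : H →ₗ[ℂ] K) := Submodule.span_le.2 h
  have h2 : IsClosed (g ⁻¹' (M : Set K)) := hM.preimage g.continuous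
  exact h2.closure_subset_iff.2 h1 (hs y)

/-- Totality of the elementary tensors, phrased through closed subspaces: in this form it can be
chained with further totality statements by taking preimages under continuous maps. -/
theorem InternalTensor.mem_of_tmul {A : Type*} [CStarAlgebra A] [PartialOrder A]
    [StarOrderedRing A] {B : Type*} [CStarAlgebra B] [PartialOrder B] [StarOrderedRing B]
    {E : Type*} [NormedAddCommGroup E] [NormedSpace ℂ E] [Module Aᵐᵒᵖ E] [CStarModule Aᵐᵒᵖ E]
    {F : Type*} [NormedAddCommGroup F] [NormedSpace ℂ F] [CompleteSpace F]
    [Module Bᵐᵒᵖ F] [CStarModule Bᵐᵒᵖ F] {φ : A →⋆ₐ[ℂ] Adj B F}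
    {M : Submodule ℂ (InternalTensor E φ)} (hM : IsClosed (M : Set (InternalTensor E φ)))
    (h : ∀ x y, InternalTensor.tmul E φ x y ∈ M) (z : InternalTensor E φ) : z ∈ M := by
  induction z using InternalTensor.induction with
  | hc => exact hM
  | h p =>
    induction p using PreTensor.induction with
    | tmul x y => exact h x y
    | add p q hp hq => rw [map_add]; exact M.add_mem hp hq

/-- Right tensoring `y ↦ x ⊙ y` with a fixed vector. -/
def InternalTensor.tmulCLM {A : Type*} [CStarAlgebra A] [PartialOrder A]
    [StarOrderedRing A] {B : Type*} [CStarAlgebra B] [PartialOrder B] [StarOrderedRing B]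
    {E : Type*} [NormedAddCommGroup E] [NormedSpace ℂ E] [Module Aᵐᵒᵖ E] [CStarModule Aᵐᵒᵖ E]
    {F : Type*} [NormedAddCommGroup F] [NormedSpace ℂ F] [CompleteSpace F]
    [Module Bᵐᵒᵖ F] [CStarModule Bᵐᵒᵖ F] (φ : A →⋆ₐ[ℂ] Adj B F) :
    E →ₗ[ℂ] F →L[ℂ] InternalTensor E φ where
  toFun x := LinearMap.mkContinuous
    { toFun := fun y => tmul E φ x y
      map_add' := tmul_add_right x
      map_smul' := fun c y => tmul_smul_right c x y } ‖x‖ (norm_tmul_le x)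
  map_add' x x' := ContinuousLinearMap.ext fun y => tmul_add_left x x' y
  map_smul' c x := ContinuousLinearMap.ext fun y => tmul_smul_left c x y

/-- Left tensoring `x ↦ x ⊙ y` with a fixed vector. -/
def InternalTensor.tmulFlipCLM {A : Type*} [CStarAlgebra A] [PartialOrder A]
    [StarOrderedRing A] {B : Type*} [CStarAlgebra B] [PartialOrder B] [StarOrderedRing B]
    {E : Type*} [NormedAddCommGroup E] [NormedSpace ℂ E] [Module Aᵐᵒᵖ E] [CStarModule Aᵐᵒᵖ E]
    {F : Type*} [NormedAddCommGroup F] [NormedSpace ℂ F] [CompleteSpace F]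
    [Module Bᵐᵒᵖ F] [CStarModule Bᵐᵒᵖ F] (φ : A →⋆ₐ[ℂ] Adj B F) (y : F) :
    E →L[ℂ] InternalTensor E φ :=
  LinearMap.mkContinuous
    { toFun := fun x => tmul E φ x y
      map_add' := fun x x' => tmul_add_left x x' y
      map_smul' := fun c x => tmul_smul_left c x y } ‖y‖ fun x => by
    rw [mul_comm]; exact norm_tmul_le x y

end DenseSpan

theorem Adj.toCLM_apply {B : Type*} [CStarAlgebra B] [PartialOrder B] [StarOrderedRing B]
    {H : Type*} [NormedAddCommGroup H] [NormedSpace ℂ H] [CompleteSpace H]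
    [Module Bᵐᵒᵖ H] [CStarModule Bᵐᵒᵖ H] (a : Adj B H) (x : H) : a.toCLM x = a x := rfl

/-! ### Unitaries from equal Gram kernels -/

section Gram

variable {B : Type*} [CStarAlgebra B] [PartialOrder B] [StarOrderedRing B]
variable {H : Type*} [NormedAddCommGroup H] [NormedSpace ℂ H] [CompleteSpace H]
  [Module Bᵐᵒᵖ H] [CStarModule Bᵐᵒᵖ H]

/-- Expand `⟨x - y, x - y⟩` into four terms. Only the inner products of `x` and `y` with `x` and `y`
themselves enter, so identities between products in `E_u` can be tested against those products
alone, without knowing that products are total. -/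
theorem rinner.eq_of {x y : H} (h1 : rinner B x x = rinner B y x)
    (h2 : rinner B x y = rinner B y y) : x = y := by
  have h (z : H) : rinner B (x - y) z = rinner B x z - rinner B y z := by
    rw [← star_eq, sub_right, star_sub, star_eq, star_eq]
  rw [← sub_eq_zero, ← self_eq_zero (B := B), sub_right, h, h, h1, h2, sub_self, sub_self,
    sub_self]

/-- Makes visible that inner products of linear combinations depend on the family only through its
Gram kernel. -/
theorem rinner_linearCombination {ι : Type*} (f : ι → H) (c d : ι →₀ ℂ) :
    rinner B (Finsupp.linearCombination ℂ f c) (Finsupp.linearCombination ℂ f d) =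
      ∑ i ∈ c.support, ∑ j ∈ d.support, d j • star (c i) • rinner B (f i) (f j) := by
  simp only [Finsupp.linearCombination_apply, Finsupp.sum, rinner.sum_left, rinner.sum_right,
    rinner.smul_left, rinner.smul_right, Finset.smul_sum]
  exact Finset.sum_comm

/-- Two families with dense span and the same Gram kernel are intertwined by a unitary. -/
theorem exists_unitary_of_gram_eq {ι : Type*} {f g : ι → H}
    (hf : Dense (Submodule.span ℂ (Set.range f) : Set H))
    (hg : Dense (Submodule.span ℂ (Set.range g) : Set H))
    (h : ∀ i j, rinner B (f i) (f j) = rinner B (g i) (g j)) :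
    ∃ U : unitary (Adj B H), ∀ i, (U : Adj B H) (f i) = g i := by
  let F := Finsupp.linearCombination ℂ f
  let G := Finsupp.linearCombination ℂ g
  have hF : DenseRange F := by
    rw [DenseRange, ← LinearMap.coe_range, Finsupp.range_linearCombination]; exact hf
  have hG : DenseRange G := by
    rw [DenseRange, ← LinearMap.coe_range, Finsupp.range_linearCombination]; exact hg
  have hFG (c d) : rinner B (F c) (F d) = rinner B (G c) (G d) := by
    rw [rinner_linearCombination, rinner_linearCombination]
    simp only [h]
  have hn (c) : ‖F c‖ = ‖G c‖ := by
    rw [← sq_eq_sq₀ (norm_nonneg _) (norm_nonneg _), rinner.norm_sq B, rinner.norm_sq B, hFG]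
  -- The assignments `F c ↦ G c` and `G c ↦ F c` are well defined and bounded because both
  -- combinations have the same norm; in particular `F c = 0` exactly when `G c = 0`.
  let U := G.extendOfNorm F
  let V := F.extendOfNorm G
  have hU (c) : U (F c) = G c :=
    LinearMap.extendOfNorm_eq hF ⟨1, fun c => by rw [one_mul, hn]⟩ c
  have hV (c) : V (G c) = F c :=
    LinearMap.extendOfNorm_eq hG ⟨1, fun c => by rw [one_mul, hn]⟩ c
  have hUV (x) : U (V x) = x := by
    refine hG.induction_on (p := fun x => U (V x) = x) x
      (isClosed_eq (by fun_prop) (by fun_prop)) fun c => ?_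
    rw [hV, hU]
  have hVU (x) : V (U x) = x := by
    refine hF.induction_on (p := fun x => V (U x) = x) x
      (isClosed_eq (by fun_prop) (by fun_prop)) fun c => ?_
    rw [hU, hV]
  -- By density it suffices to take `x = F c` and `y = G d`, where both sides are inner products of
  -- combinations with coefficients `c` and `d`: `⟨G c, G d⟩ = ⟨F c, F d⟩`.
  have hadj (x y) : rinner B (U x) y = rinner B x (V y) := by
    refine hF.induction_on (p := fun x => rinner B (U x) y = rinner B x (V y)) x
      (isClosed_eq (rinner.continuous_comp U.continuous continuous_const)
        (rinner.continuous_comp continuous_id continuous_const)) fun c => ?_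
    refine hG.induction_on (p := fun y => rinner B (U (F c)) y = rinner B (F c) (V y)) y
      (isClosed_eq (rinner.continuous_comp continuous_const continuous_id)
        (rinner.continuous_comp continuous_const V.continuous)) fun d => ?_
    rw [hU, hV, hFG]
  have hstar : star (Adj.mk U V hadj) = Adj.mk V U fun x y => by
      rw [← rinner.star_eq, ← hadj, rinner.star_eq] :=
    Adj.star_eq_of _ _ hadj
  refine ⟨⟨Adj.mk U V hadj, Unitary.mem_iff.2 ⟨?_, ?_⟩⟩, fun i => ?_⟩
  · rw [hstar]; exact Adj.ext' hVU
  · rw [hstar]; exact Adj.ext' hUV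
  · have : U (F (Finsupp.single i 1)) = G (Finsupp.single i 1) := hU _
    simp only [F, G] at this
    rwa [Finsupp.linearCombination_single, Finsupp.linearCombination_single, one_smul,
      one_smul] at this

end Gram

namespace E0Semigroup

/-! ### The algebra of the product system, its right action on `E`, and density from strictness -/

section MulTo

variable {T : Type*} [AddCommMonoid T]
variable {B : Type*} [CStarAlgebra B] [PartialOrder B] [StarOrderedRing B]
variable {E : Type*} [NormedAddCommGroup E] [NormedSpace ℂ E] [CompleteSpace E]
  [Module Bᵐᵒᵖ E] [CStarModule Bᵐᵒᵖ E]
variable (ϑ : E0Semigroup T B E) {s t u r w : T}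

theorem mul_elem (x x' : E) (q : ϑ.Fiber t) :
    ϑ.mul s t (ϑ.elem s x x') q = ϑ.elem (s + t) x (ϑ.act t x' q) :=
  congrArg (fun f => f q) (ϑ.mul_ofPre s t (PreTensor.mk _ _ (DualModule.of B x) x'))

/-- Connects `u_{s,t}`, in terms of which units are defined, with the bounded bilinear
multiplication used in all computations. -/
theorem productMap_tmul (p : ϑ.Fiber s) (q : ϑ.Fiber t) :
    ϑ.productMap s t (InternalTensor.tmul (ϑ.Fiber s) (ϑ.leftAction t) p q) = ϑ.mul s t p q :=
  InternalTensor.lift_tmul _ _ _ _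

/-- The multiplication `E_s × E_t → E_u` of the product system for `u = s + t`. -/
def mulTo (h : s + t = u) : ϑ.Fiber s →L[ℂ] ϑ.Fiber t →L[ℂ] ϑ.Fiber u := h ▸ ϑ.mul s t

theorem mulTo_rfl : ϑ.mulTo (rfl : s + t = s + t) = ϑ.mul s t := rfl

theorem mulTo_elem (h : s + t = u) (x x' : E) (q : ϑ.Fiber t) :
    ϑ.mulTo h (ϑ.elem s x x') q = ϑ.elem u x (ϑ.act t x' q) := by
  subst h; exact ϑ.mul_elem x x' q

theorem rinner_mulTo (h : s + t = u) (p p' : ϑ.Fiber s) (q q' : ϑ.Fiber t) :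
    rinner B (ϑ.mulTo h p q) (ϑ.mulTo h p' q') =
      rinner B q (ϑ.leftAction t (rinner B p p') q') := by
  subst h; exact ϑ.rinner_mul s t p p' q q'

theorem fiber_hom_ext {G : Type*} [NormedAddCommGroup G] [NormedSpace ℂ G]
    {f g : ϑ.Fiber t →L[ℂ] G} (h : ∀ x y, f (ϑ.elem t x y) = g (ϑ.elem t x y)) : f = g :=
  InternalTensor.hom_ext fun x y => h x.vec y

theorem leftAction_elem (b : B) (x y : E) :
    ϑ.leftAction t b (ϑ.elem t x y) = ϑ.elem t (MulOpposite.op (star b) • x) y :=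
  InternalTensor.amplify_tmul (E := DualModule B E) (φ := ϑ.hom t) _ _ _

/-- The product is balanced over `B`. Both sides are themselves products, so by `rinner.eq_of` it is
enough to compare their inner products with an arbitrary `p' q'`, and these are given by
`rinner_mulTo`. -/
theorem mulTo_op_smul_left (h : s + t = u) (b : B) (p : ϑ.Fiber s) (q : ϑ.Fiber t) :
    ϑ.mulTo h (MulOpposite.op b • p) q = ϑ.mulTo h p (ϑ.leftAction t b q) := by
  have key (p' : ϑ.Fiber s) (q' : ϑ.Fiber t) :
      rinner B (ϑ.mulTo h (MulOpposite.op b • p) q) (ϑ.mulTo h p' q') =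
        rinner B (ϑ.mulTo h p (ϑ.leftAction t b q)) (ϑ.mulTo h p' q') := by
    rw [rinner_mulTo, rinner_mulTo, rinner.op_smul_left, map_mul, Adj.mul_apply, map_star,
      ← Adj.rinner_left]
  exact rinner.eq_of (key _ _) (key _ _)

theorem mulTo_op_smul_right (h : s + t = u) (b : B) (p : ϑ.Fiber s) (q : ϑ.Fiber t) :
    ϑ.mulTo h p (MulOpposite.op b • q) = MulOpposite.op b • ϑ.mulTo h p q := by
  have key (p' : ϑ.Fiber s) (q' : ϑ.Fiber t) :
      rinner B (ϑ.mulTo h p (MulOpposite.op b • q)) (ϑ.mulTo h p' q') =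
        rinner B (MulOpposite.op b • ϑ.mulTo h p q) (ϑ.mulTo h p' q') := by
    rw [rinner_mulTo, rinner.op_smul_left, rinner.op_smul_left, rinner_mulTo]
  refine rinner.eq_of (key _ _) ?_
  -- The vector `(p q) b` is not literally a product, so `b` is first pulled out of the second
  -- argument; `key` then applies to `p q`.
  rw [rinner.op_smul_right, key, rinner.op_smul_right]

attribute [irreducible] mulTo

/-- On `x* ⊙_s x'` the algebra `B` acts only on the factor `x*`, which the product leaves alone.
This makes the embeddings `p ↦ p ω_r` left linear. -/
theorem mulTo_leftAction (h : s + t = u) (b : B) (p : ϑ.Fiber s) (q : ϑ.Fiber t) :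
    ϑ.mulTo h (ϑ.leftAction s b p) q = ϑ.leftAction u b (ϑ.mulTo h p q) := by
  have : ((ϑ.mulTo h).flip q).comp (ϑ.leftAction s b).toCLM =
      (ϑ.leftAction u b).toCLM.comp ((ϑ.mulTo h).flip q) := by
    refine ϑ.fiber_hom_ext fun x y => ?_
    rw [ContinuousLinearMap.comp_apply, ContinuousLinearMap.flip_apply,
      ContinuousLinearMap.comp_apply, ContinuousLinearMap.flip_apply, Adj.toCLM_apply,
      Adj.toCLM_apply, leftAction_elem, mulTo_elem, mulTo_elem, leftAction_elem]
  exact congrArg (fun f => f p) this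

/-- From `⟨x q, x q⟩ = ⟨q, ⟨x, x⟩ q⟩` and contractivity of the left action. It gives continuity in
`x` for fixed `q`. -/
theorem norm_act_le (x : E) (q : ϑ.Fiber t) : ‖ϑ.act t x q‖ ≤ ‖q‖ * ‖x‖ := by
  refine le_of_sq_le_sq ?_ (by positivity)
  rw [rinner.norm_sq B, rinner_act]
  calc _ ≤ ‖q‖ * ‖ϑ.leftAction t (rinner B x x) q‖ := rinner.norm_le _ _
    _ ≤ ‖q‖ * (‖rinner B x x‖ * ‖q‖) := by
      gcongr
      exact (Adj.norm_apply_le _ _).trans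
        (by gcongr; exact NonUnitalStarAlgHom.norm_apply_le (ϑ.leftAction t) _)
    _ = _ := by rw [← rinner.norm_sq]; ring

/-- The bounded operator `x ↦ u_t(x ⊙ q)`. -/
def actFlip (q : ϑ.Fiber t) : E →L[ℂ] E :=
  LinearMap.mkContinuous
    { toFun := fun x => ϑ.act t x q
      map_add' := fun x y => by rw [map_add, add_apply]
      map_smul' := fun c x => by rw [map_smul, smul_apply]; rfl } ‖q‖ fun x => ϑ.norm_act_le x q

theorem actFlip_apply (q : ϑ.Fiber t) (x : E) : ϑ.actFlip q x = ϑ.act t x q := rfl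

/-- Associativity `x (p q) = (x p) q` of the right action. For `p = y* ⊙_s z` both sides are an
endomorphism applied to `z q`: `ϑ_{s+t}(x y*)` on the left and `ϑ_t(ϑ_s(x y*))` on the right, so
this is the semigroup law of `ϑ`. -/
theorem act_mulTo (h : s + t = u) (x : E) (p : ϑ.Fiber s) (q : ϑ.Fiber t) :
    ϑ.act u x (ϑ.mulTo h p q) = ϑ.act t (ϑ.act s x p) q := by
  have : (ϑ.act u x).comp ((ϑ.mulTo h).flip q) = (ϑ.actFlip q).comp (ϑ.act s x) := by
    refine ϑ.fiber_hom_ext fun y z => ?_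
    rw [ContinuousLinearMap.comp_apply, ContinuousLinearMap.flip_apply,
      ContinuousLinearMap.comp_apply, actFlip_apply, mulTo_elem, act_elem, act_elem, act_apply,
      ← h, hom_add_apply]
  exact congrArg (fun f => f p) this

/-- With `p = x* ⊙_s y` the factor `x*` is untouched and the claim reduces to `act_mulTo` for `y`.
The four time equations are free parameters because `E_{(s+t)+r}` and `E_{s+(t+r)}` are fibres at
formally different times. -/
theorem mulTo_assoc {st tu : T} (h₁ : s + t = st) (h₂ : st + r = w) (h₃ : t + r = tu)
    (h₄ : s + tu = w) (p : ϑ.Fiber s) (q : ϑ.Fiber t) (q' : ϑ.Fiber r) :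
    ϑ.mulTo h₂ (ϑ.mulTo h₁ p q) q' = ϑ.mulTo h₄ p (ϑ.mulTo h₃ q q') := by
  have : ((ϑ.mulTo h₂).flip q').comp ((ϑ.mulTo h₁).flip q) =
      (ϑ.mulTo h₄).flip (ϑ.mulTo h₃ q q') := by
    refine ϑ.fiber_hom_ext fun x y => ?_
    rw [ContinuousLinearMap.comp_apply, ContinuousLinearMap.flip_apply,
      ContinuousLinearMap.flip_apply, ContinuousLinearMap.flip_apply, mulTo_elem, mulTo_elem, mulTo_elem, act_mulTo]
  exact congrArg (fun f => f p) this

/-- Strictness speaks of all compact operators; since `ϑ_t` is contractive, norm limits of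
combinations of rank-one operators contribute nothing beyond the closed span. -/
theorem dense_span_hom_rankOne (h : IsStrict (ϑ.hom t)) :
    Dense (Submodule.span ℂ
      (Set.range fun z : E × E × E => ϑ.hom t (rankOne B z.1 z.2.1) z.2.2) : Set E) := by
  set M := (Submodule.span ℂ
    (Set.range fun z : E × E × E => ϑ.hom t (rankOne B z.1 z.2.1) z.2.2)).topologicalClosure
  have hM : IsClosed (M : Set E) := Submodule.isClosed_topologicalClosure _
  have key : ∀ k ∈ compactOperators B E, ∀ x, ϑ.hom t k x ∈ M := by
    intro k hk x
    have hc : Continuous fun k : Adj B E => ϑ.hom t k x := by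
      have h1 : Continuous (ϑ.hom t) :=
        AddMonoidHomClass.continuous_of_bound (ϑ.hom t) 1 fun b => by
          rw [one_mul]; exact NonUnitalStarAlgHom.norm_apply_le (ϑ.hom t) b
      have h2 : Continuous (Adj.toCLM : Adj B E → _) := continuous_subtype_val
      exact (ContinuousLinearMap.apply ℂ _ x).continuous.comp (h2.comp h1)
    refine (hM.preimage hc).closure_subset_iff.2 (fun k hk => ?_) hk
    change ϑ.hom t k x ∈ M
    refine Submodule.span_induction (p := fun k _ => ϑ.hom t k x ∈ M) ?_ ?_ ?_ ?_ hk
    · rintro _ ⟨z, rfl⟩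
      exact Submodule.le_topologicalClosure _ (Submodule.subset_span ⟨(z.1, z.2, x), rfl⟩)
    · rw [map_zero]; exact M.zero_mem
    · intro a b _ _ ha hb
      rw [map_add]; exact M.add_mem ha hb
    · intro c a _ ha
      rw [map_smul]; exact M.smul_mem c ha
  rw [Submodule.dense_iff_topologicalClosure_eq_top, eq_top_iff]
  rintro y -
  refine (ContinuousLinearMap.id ℂ E).mem_of_dense_span h hM ?_ y
  rintro _ ⟨k, hk, x, rfl⟩
  exact key k hk x

/-- This is the surjectivity half of `E ⊙ E_t ≅ E`: the vectors `ϑ_t(x y*) z` are exactly `x · (y*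
⊙_t z)`. -/
theorem dense_span_act (h : IsStrict (ϑ.hom t)) :
    Dense (Submodule.span ℂ (Set.range fun z : E × ϑ.Fiber t => ϑ.act t z.1 z.2) : Set E) := by
  refine (ϑ.dense_span_hom_rankOne h).mono (Submodule.span_mono ?_)
  rintro _ ⟨⟨x, y, z⟩, rfl⟩
  exact ⟨(x, ϑ.elem t y z), ϑ.act_elem t x y z⟩

/-- The surjectivity half of `E_s ⊙ E_t ≅ E_u`. Since `(x* ⊙_s y) q = x* ⊙_u (y q)`, it follows from
totality of the vectors `y q` in `E`; hence only strictness at the time of the second factor is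
needed. -/
theorem dense_span_mulTo (h : s + t = u) (ht : IsStrict (ϑ.hom t)) :
    Dense (Submodule.span ℂ
      (Set.range fun z : ϑ.Fiber s × ϑ.Fiber t => ϑ.mulTo h z.1 z.2) : Set (ϑ.Fiber u)) := by
  rw [Submodule.dense_iff_topologicalClosure_eq_top, eq_top_iff]
  rintro y -
  refine InternalTensor.mem_of_tmul (Submodule.isClosed_topologicalClosure _) (fun x => ?_) y
  refine (ϑ.creation u x).mem_of_dense_span (ϑ.dense_span_act ht)
    (Submodule.isClosed_topologicalClosure _) ?_
  rintro _ ⟨⟨y, q⟩, rfl⟩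
  refine Submodule.le_topologicalClosure _ (Submodule.subset_span
    ⟨(ϑ.elem s x.vec y, q), ?_⟩)
  exact ϑ.mulTo_elem h _ _ _

end MulTo

end E0Semigroup

end

/-! ### The algebraic inductive limit of the `E_t` along `p ↦ p ω_r` -/

noncomputable section

/-- A submonoid of `ℝ` that contains a positive element and all positive differences of its
elements. -/
class AddSubmonoid.IsTimeSet (T : AddSubmonoid ℝ) : Prop where
  exists_add_of_lt : ∀ s t : T, s < t → ∃ r : T, 0 < r ∧ s + r = t
  exists_pos : ∃ t : T, 0 < t

namespace E0Semigroup

namespace CentralUnitalUnit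

open Filter

variable {T : AddSubmonoid ℝ} [T.IsTimeSet]
variable {B : Type*} [CStarAlgebra B] [PartialOrder B] [StarOrderedRing B]
variable {E : Type*} [NormedAddCommGroup E] [NormedSpace ℂ E] [CompleteSpace E]
  [Module Bᵐᵒᵖ E] [CStarModule Bᵐᵒᵖ E]
variable {ϑ : E0Semigroup T B E} (ω : ϑ.CentralUnitalUnit) {s t u r : T}

theorem mulTo_vec_vec (h : s + t = u) (hs : 0 < s) (ht : 0 < t) (hu : 0 < u) :
    ϑ.mulTo h (ω.vec s hs) (ω.vec t ht) = ω.vec u hu := by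
  subst h
  rw [mulTo_rfl, ← productMap_tmul]
  exact ω.unit s t hs ht

/-- Centrality and unitality give `⟨p ω, q ω⟩ = ⟨ω, ⟨p, q⟩ ω⟩ = ⟨ω, ω⟩ ⟨p, q⟩ = ⟨p, q⟩`. So the
embeddings of the inductive system are isometric. -/
theorem rinner_mulTo_vec (h : s + t = u) (ht : 0 < t) (p q : ϑ.Fiber s) :
    rinner B (ϑ.mulTo h p (ω.vec t ht)) (ϑ.mulTo h q (ω.vec t ht)) = rinner B p q := by
  rw [rinner_mulTo, ω.central, rinner.op_smul_right, ω.unital, one_mul]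

/-- Balancing moves `b` in front of `ω_r` and centrality carries it to the right of it. Without
centrality the embeddings would not be expected to be right linear. -/
theorem mulTo_op_smul_vec (h : s + t = u) (ht : 0 < t) (b : B) (p : ϑ.Fiber s) :
    ϑ.mulTo h (MulOpposite.op b • p) (ω.vec t ht) =
      MulOpposite.op b • ϑ.mulTo h p (ω.vec t ht) := by
  rw [mulTo_op_smul_left, ω.central, mulTo_op_smul_right]

/-- The family `f` is obtained after time `s` by multiplying `f s` with the unit. -/
def CoherentFrom (f : ∀ t, ϑ.Fiber t) (s : T) : Prop :=
  ∀ (r : T) (hr : 0 < r) (t : T) (h : s + r = t), f t = ϑ.mulTo h (f s) (ω.vec r hr)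

/-- The eventually coherent families, which represent the vectors of the algebraic inductive limit
of the `E_t` along the embeddings `p ↦ p ω_r`. -/
def coherentFamilies : Submodule ℂ (∀ t, ϑ.Fiber t) where
  carrier := {f | ∀ᶠ s in atTop, ω.CoherentFrom f s}
  zero_mem' := Eventually.of_forall fun s r hr t h => by
    rw [Pi.zero_apply, Pi.zero_apply, map_zero, zero_apply]
  add_mem' {f g} hf hg := by
    filter_upwards [hf, hg] with s hf hg r hr t h
    rw [Pi.add_apply, Pi.add_apply, hf r hr t h, hg r hr t h, map_add, add_apply]
  smul_mem' c f hf := by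
    filter_upwards [hf] with s hf r hr t h
    rw [Pi.smul_apply, Pi.smul_apply, hf r hr t h, map_smul, smul_apply]

/-- The algebraic inductive limit of the `E_t`, as a semi-inner product module. -/
def PreLimit : Type _ := ω.coherentFamilies

namespace PreLimit

instance : AddCommGroup ω.PreLimit := inferInstanceAs (AddCommGroup ω.coherentFamilies)

instance : Module ℂ ω.PreLimit := inferInstanceAs (Module ℂ ω.coherentFamilies)

variable {ω}

/-- The value of the family at `t`. -/
def val (f : ω.PreLimit) (t : T) : ϑ.Fiber t := Subtype.val f t

theorem eventually_coherent (f : ω.PreLimit) : ∀ᶠ s in atTop, ω.CoherentFrom f.val s := f.2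

theorem val_add (f g : ω.PreLimit) (t : T) : (f + g).val t = f.val t + g.val t := rfl

theorem val_smul (c : ℂ) (f : ω.PreLimit) (t : T) : (c • f).val t = c • f.val t := rfl

theorem ext {f g : ω.PreLimit} (h : ∀ t, f.val t = g.val t) : f = g :=
  Subtype.ext (funext h)

/-- Right multiplication by `b`, pointwise. -/
instance : SMul Bᵐᵒᵖ ω.PreLimit where
  smul b f := ⟨fun t => b • f.val t, by
    obtain ⟨b, rfl⟩ := MulOpposite.op_surjective b
    filter_upwards [f.eventually_coherent] with s hf r hr t h
    simp only [hf r hr t h, mulTo_op_smul_vec]⟩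

theorem val_op_smul (b : Bᵐᵒᵖ) (f : ω.PreLimit) (t : T) : (b • f).val t = b • f.val t := rfl

instance : Module Bᵐᵒᵖ ω.PreLimit where
  one_smul _ := ext fun _ => one_smul _ _
  mul_smul _ _ _ := ext fun _ => mul_smul _ _ _
  smul_zero _ := ext fun _ => smul_zero _
  smul_add _ _ _ := ext fun _ => smul_add _ _ _
  add_smul _ _ _ := ext fun _ => add_smul _ _ _
  zero_smul _ := ext fun _ => zero_smul _ _

/-- The eventual value of `⟨f_t, g_t⟩`. -/
def formAux (f g : ω.PreLimit) : B := limUnder atTop fun t => rinner B (f.val t) (g.val t)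

/-- Once both families are coherent from `s`, passing to a later time multiplies both by the same
`ω_r`, which preserves inner products. Thus `⟨f_t, g_t⟩` is eventually constant, and every algebraic
identity or inequality for the limit form can be read off in a single fibre at one late time. -/
theorem eventually_formAux (f g : ω.PreLimit) :
    ∀ᶠ t in atTop, formAux f g = rinner B (f.val t) (g.val t) := by
  obtain ⟨s, hf, hg⟩ := (f.eventually_coherent.and g.eventually_coherent).exists
  have h : ∀ᶠ t in atTop, rinner B (f.val s) (g.val s) = rinner B (f.val t) (g.val t) := by
    filter_upwards [eventually_ge_atTop s] with t ht
    rcases ht.eq_or_lt with rfl | ht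
    · rfl
    · obtain ⟨r, hr, h⟩ := AddSubmonoid.IsTimeSet.exists_add_of_lt s t ht
      rw [hf r hr t h, hg r hr t h, rinner_mulTo_vec]
  have h1 : formAux f g = rinner B (f.val s) (g.val s) :=
    (tendsto_const_nhds.congr' h).limUnder_eq
  rwa [h1]

/-- The semi-inner product `lim ⟨f_t, g_t⟩`. -/
def form : ω.PreLimit →ₗ⋆[ℂ] ω.PreLimit →ₗ[ℂ] B :=
  LinearMap.mk₂'ₛₗ (starRingEnd ℂ) (RingHom.id ℂ) formAux
    (fun f f' g => by
      obtain ⟨t, h1, h2, h3⟩ := ((eventually_formAux (f + f') g).and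
        ((eventually_formAux f g).and (eventually_formAux f' g))).exists
      rw [h1, h2, h3, val_add, rinner.add_left])
    (fun c f g => by
      obtain ⟨t, h1, h2⟩ := ((eventually_formAux (c • f) g).and
        (eventually_formAux f g)).exists
      rw [h1, h2, val_smul, rinner.smul_left]; rfl)
    (fun f g g' => by
      obtain ⟨t, h1, h2, h3⟩ := ((eventually_formAux f (g + g')).and
        ((eventually_formAux f g).and (eventually_formAux f g'))).exists
      rw [h1, h2, h3, val_add, rinner.add_right])
    (fun c f g => by
      obtain ⟨t, h1, h2⟩ := ((eventually_formAux f (c • g)).and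
        (eventually_formAux f g)).exists
      rw [h1, h2, val_smul, rinner.smul_right]; rfl)

theorem eventually_form (f g : ω.PreLimit) :
    ∀ᶠ t in atTop, form f g = rinner B (f.val t) (g.val t) := eventually_formAux f g

theorem form_op_smul_right (b : B) (f g : ω.PreLimit) :
    form f (MulOpposite.op b • g) = form f g * b := by
  obtain ⟨t, h1, h2⟩ := ((eventually_form f (MulOpposite.op b • g)).and
    (eventually_form f g)).exists
  rw [h1, h2, val_op_smul, rinner.op_smul_right]

theorem star_form (f g : ω.PreLimit) : star (form f g) = form g f := by
  obtain ⟨t, h1, h2⟩ := ((eventually_form f g).and (eventually_form g f)).exists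
  rw [h1, h2, rinner.star_eq]

theorem form_self_nonneg (f : ω.PreLimit) : 0 ≤ form f f := by
  obtain ⟨t, h⟩ := (eventually_form f f).exists
  rw [h]
  exact rinner.self_nonneg _

/-- Identifies the seminorm with the norm of a fibre at all late times, so that its properties are
inherited from the `E_t`. -/
theorem eventually_norm (f : ω.PreLimit) : ∀ᶠ t in atTop, √‖form f f‖ = ‖f.val t‖ := by
  filter_upwards [eventually_form f f] with t h
  rw [h, ← rinner.norm_sq, Real.sqrt_sq (norm_nonneg _)]

/-- The seminorm `lim ‖f_t‖`. -/
instance : SeminormedAddCommGroup ω.PreLimit :=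
  AddGroupSeminorm.toSeminormedAddCommGroup
    { toFun := fun f => √‖form f f‖
      map_zero' := by simp
      add_le' := fun f g => by
        obtain ⟨t, h1, h2, h3⟩ := ((eventually_norm (f + g)).and
          ((eventually_norm f).and (eventually_norm g))).exists
        rw [h1, h2, h3, val_add]
        exact norm_add_le _ _
      neg' := fun f => by simp }

theorem eventually_norm_eq (f : ω.PreLimit) : ∀ᶠ t in atTop, ‖f‖ = ‖f.val t‖ := eventually_norm f

theorem norm_sq (f : ω.PreLimit) : ‖f‖ ^ 2 = ‖form f f‖ := Real.sq_sqrt (norm_nonneg _)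

theorem norm_form_le (f g : ω.PreLimit) : ‖form f g‖ ≤ ‖f‖ * ‖g‖ := by
  obtain ⟨t, h1, h2, h3⟩ := ((eventually_form f g).and
    ((eventually_norm_eq f).and (eventually_norm_eq g))).exists
  rw [h1, h2, h3]
  exact rinner.norm_le _ _

instance : NormedSpace ℂ ω.PreLimit where
  norm_smul_le c f := by
    obtain ⟨t, h1, h2⟩ := ((eventually_norm_eq (c • f)).and (eventually_norm_eq f)).exists
    rw [h1, h2, val_smul, norm_smul]

theorem norm_op_smul_le (b : Bᵐᵒᵖ) (f : ω.PreLimit) : ‖b • f‖ ≤ ‖b‖ * ‖f‖ := by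
  obtain ⟨t, h1, h2⟩ := ((eventually_norm_eq (b • f)).and (eventually_norm_eq f)).exists
  rw [h1, h2, val_op_smul]
  exact norm_op_smul_le' B b.unop _

instance : UniformContinuousConstSMul Bᵐᵒᵖ ω.PreLimit where
  uniformContinuous_const_smul b :=
    (AddMonoidHomClass.lipschitz_of_bound (DistribSMul.toAddMonoidHom ω.PreLimit b) ‖b‖
      (norm_op_smul_le b)).uniformContinuous

instance : Inner Bᵐᵒᵖ ω.PreLimit where
  inner f g := MulOpposite.op (form f g)

theorem continuous_form : Continuous fun z : ω.PreLimit × ω.PreLimit => form z.1 z.2 := by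
  let g : ω.PreLimit →L⋆[ℂ] ω.PreLimit →L[ℂ] B :=
    LinearMap.mkContinuous₂ form 1 fun p q => by rw [one_mul]; exact norm_form_le p q
  have h : Continuous fun z : ω.PreLimit × ω.PreLimit => g z.1 z.2 := by fun_prop
  exact h

/-- The left multiplication by `b`, pointwise. -/
def left (b : B) : ω.PreLimit →ₗ[ℂ] ω.PreLimit where
  toFun f := ⟨fun t => ϑ.leftAction t b (f.val t), by
    filter_upwards [f.eventually_coherent] with s hf r hr t h
    simp only [hf r hr t h, mulTo_leftAction]⟩
  map_add' f g := ext fun t => map_add (ϑ.leftAction t b) _ _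
  map_smul' c f := ext fun t => map_smul (ϑ.leftAction t b) _ _

theorem val_left (b : B) (f : ω.PreLimit) (t : T) :
    (left b f).val t = ϑ.leftAction t b (f.val t) := rfl

theorem form_left (b : B) (f g : ω.PreLimit) : form (left b f) g = form f (left (star b) g) := by
  obtain ⟨t, h1, h2⟩ := ((eventually_form (left b f) g).and
    (eventually_form f (left (star b) g))).exists
  rw [h1, h2, val_left, val_left, map_star, Adj.rinner_left]

theorem norm_left_le (b : B) (f : ω.PreLimit) : ‖left b f‖ ≤ ‖b‖ * ‖f‖ := by
  obtain ⟨t, h1, h2⟩ := ((eventually_norm_eq (left b f)).and (eventually_norm_eq f)).exists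
  rw [h1, h2, val_left]
  refine (Adj.norm_apply_le _ _).trans ?_
  gcongr
  exact NonUnitalStarAlgHom.norm_apply_le (ϑ.leftAction t) _

/-- The left multiplication by `b` as a bounded operator. -/
def leftCLM (b : B) : ω.PreLimit →L[ℂ] ω.PreLimit :=
  LinearMap.mkContinuous (left b) ‖b‖ (norm_left_le b)

variable (ω) in
open Classical in
/-- The family that is `p` multiplied by the unit after time `s`. -/
def inclFun (p : ϑ.Fiber s) (t : T) : ϑ.Fiber t :=
  if h : ∃ r : T, 0 < r ∧ s + r = t then
    ϑ.mulTo h.choose_spec.2 p (ω.vec h.choose h.choose_spec.1) else 0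

/-- The increment `r` with `s + r = t` is unique by cancellation, so the choice made in `inclFun` is
immaterial. -/
theorem inclFun_eq (p : ϑ.Fiber s) (hr : 0 < r) (h : s + r = t) :
    inclFun ω p t = ϑ.mulTo h p (ω.vec r hr) := by
  have key (r' : T) (hr' : 0 < r') (h' : s + r' = t) :
      ϑ.mulTo h' p (ω.vec r' hr') = ϑ.mulTo h p (ω.vec r hr) := by
    obtain rfl := add_left_cancel (h'.trans h.symm)
    rfl
  rw [inclFun, dif_pos ⟨r, hr, h⟩]
  exact key _ _ _

theorem inclFun_add (p q : ϑ.Fiber s) (t : T) :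
    inclFun ω (p + q) t = inclFun ω p t + inclFun ω q t := by
  by_cases h : ∃ r : T, 0 < r ∧ s + r = t
  · obtain ⟨r, hr, h⟩ := h
    rw [inclFun_eq _ hr h, inclFun_eq _ hr h, inclFun_eq _ hr h, map_add, add_apply]
  · rw [inclFun, inclFun, inclFun, dif_neg h, dif_neg h, dif_neg h, add_zero]

theorem inclFun_smul (c : ℂ) (p : ϑ.Fiber s) (t : T) :
    inclFun ω (c • p) t = c • inclFun ω p t := by
  by_cases h : ∃ r : T, 0 < r ∧ s + r = t
  · obtain ⟨r, hr, h⟩ := h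
    rw [inclFun_eq _ hr h, inclFun_eq _ hr h, map_smul, smul_apply]
  · rw [inclFun, inclFun, dif_neg h, dif_neg h, smul_zero]

/-- Follows from associativity and `ω_d ω_r = ω_{d+r}`. The inequality is strict because the family
has the default value `0` wherever `t` is not strictly after `s`, including `t = s`. -/
theorem coherentFrom_inclFun (p : ϑ.Fiber s) (h : s < t) :
    ω.CoherentFrom (inclFun ω p) t := by
  obtain ⟨d, hd, hsd⟩ := AddSubmonoid.IsTimeSet.exists_add_of_lt s t h
  intro r hr u hu
  rw [inclFun_eq p hd hsd, inclFun_eq p (add_pos hd hr) (by rw [← add_assoc, hsd, hu]),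
    ϑ.mulTo_assoc hsd hu rfl, ω.mulTo_vec_vec rfl hd hr]

/-- Ensures that times strictly after a given `s` are eventual along `atTop`. -/
instance : NoMaxOrder T where
  exists_gt s := by
    obtain ⟨d, hd⟩ := AddSubmonoid.IsTimeSet.exists_pos (T := T)
    exact ⟨s + d, lt_add_of_pos_right s hd⟩

variable (ω s) in
/-- The canonical map of `E_s` into the algebraic inductive limit. -/
def incl : ϑ.Fiber s →ₗ[ℂ] ω.PreLimit where
  toFun p := ⟨inclFun ω p, by
    filter_upwards [eventually_gt_atTop s] with t ht using coherentFrom_inclFun p ht⟩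
  map_add' p q := ext fun t => inclFun_add p q t
  map_smul' c p := ext fun t => inclFun_smul c p t

theorem val_incl (p : ϑ.Fiber s) (hr : 0 < r) (h : s + r = t) :
    (incl ω s p).val t = ϑ.mulTo h p (ω.vec r hr) := inclFun_eq p hr h

/-- The increment depends on `t` but not on `p`, so several vectors of `E_s` can be compared at the
same late time. -/
theorem eventually_incl (s : T) : ∀ᶠ t in atTop, ∃ (r : T) (hr : 0 < r) (h : s + r = t),
    ∀ p : ϑ.Fiber s, (incl ω s p).val t = ϑ.mulTo h p (ω.vec r hr) := by
  filter_upwards [eventually_gt_atTop s] with t ht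
  obtain ⟨r, hr, h⟩ := AddSubmonoid.IsTimeSet.exists_add_of_lt s t ht
  exact ⟨r, hr, h, fun p => val_incl p hr h⟩

theorem form_incl (p q : ϑ.Fiber s) : form (incl ω s p) (incl ω s q) = rinner B p q := by
  obtain ⟨t, h, r, hr, hs, h'⟩ := ((eventually_form (incl ω s p) (incl ω s q)).and
    (eventually_incl (ω := ω) s)).exists
  rw [h, h', h', rinner_mulTo_vec]

theorem norm_sub_eq_zero {f g : ω.PreLimit} (h : ∀ᶠ t in atTop, f.val t = g.val t) :
    ‖f - g‖ = 0 := by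
  obtain ⟨t, h1, h2⟩ := ((eventually_norm_eq (f - g)).and h).exists
  rw [h1]
  change ‖f.val t - g.val t‖ = 0
  rw [h2, sub_self, norm_zero]

/-- Choose a positive `s` from which `f` is coherent: then `f` and the image of `f_s` agree at all
times strictly after `s`. Hence, up to null vectors, the limit is the union of the images of the
`E_s`, and positive times suffice. -/
theorem exists_norm_sub_incl_eq_zero (f : ω.PreLimit) :
    ∃ s : T, 0 < s ∧ ‖f - incl ω s (f.val s)‖ = 0 := by
  obtain ⟨s, h, hs⟩ := (f.eventually_coherent.and (eventually_gt_atTop 0)).exists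
  refine ⟨s, hs, norm_sub_eq_zero ?_⟩
  filter_upwards [eventually_incl (ω := ω) s] with t ⟨r, hr, h1, h2⟩
  rw [h r hr t h1, h2]

end PreLimit

/-! ### The Hilbert module `E_-`: completion, left action and embeddings of the `E_s` -/

/-- The inductive limit of the `E_t`, as a Hilbert module. -/
def Limit : Type _ := UniformSpace.Completion ω.PreLimit

namespace Limit

instance : NormedAddCommGroup ω.Limit :=
  inferInstanceAs (NormedAddCommGroup (UniformSpace.Completion ω.PreLimit))

instance : NormedSpace ℂ ω.Limit :=
  inferInstanceAs (NormedSpace ℂ (UniformSpace.Completion ω.PreLimit))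

instance : CompleteSpace ω.Limit :=
  inferInstanceAs (CompleteSpace (UniformSpace.Completion ω.PreLimit))

instance : Module Bᵐᵒᵖ ω.Limit :=
  inferInstanceAs (Module Bᵐᵒᵖ (UniformSpace.Completion ω.PreLimit))

instance : UniformContinuousConstSMul Bᵐᵒᵖ ω.Limit :=
  inferInstanceAs (UniformContinuousConstSMul Bᵐᵒᵖ (UniformSpace.Completion ω.PreLimit))

instance : Inner Bᵐᵒᵖ ω.Limit :=
  inferInstanceAs (Inner Bᵐᵒᵖ (UniformSpace.Completion ω.PreLimit))

/-- The canonical map of the algebraic inductive limit into its separated completion. -/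
def ofPre : ω.PreLimit →L[ℂ] ω.Limit :=
  (UniformSpace.Completion.toComplL : ω.PreLimit →L[ℂ] UniformSpace.Completion ω.PreLimit)

variable {ω}

theorem norm_ofPre (p : ω.PreLimit) : ‖ofPre ω p‖ = ‖p‖ := UniformSpace.Completion.norm_coe p

theorem op_smul_ofPre (b : Bᵐᵒᵖ) (p : ω.PreLimit) : b • ofPre ω p = ofPre ω (b • p) :=
  (UniformSpace.Completion.coe_smul b p).symm

theorem inner_ofPre (p q : ω.PreLimit) :
    inner Bᵐᵒᵖ (ofPre ω p) (ofPre ω q) = MulOpposite.op (PreLimit.form p q) :=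
  (UniformSpace.Completion.isDenseInducing_coe.prodMap
    UniformSpace.Completion.isDenseInducing_coe).extend_eq
    (f := Function.uncurry (inner Bᵐᵒᵖ : ω.PreLimit → ω.PreLimit → Bᵐᵒᵖ))
    (MulOpposite.continuous_op.comp PreLimit.continuous_form) (p, q)

theorem continuous_inner :
    Continuous fun z : ω.Limit × ω.Limit => inner Bᵐᵒᵖ z.1 z.2 := by
  let inner' : ω.PreLimit →+ ω.PreLimit →+ Bᵐᵒᵖ :=
    { toFun := fun x => (MulOpposite.opAddEquiv.toAddMonoidHom).comp
        (PreLimit.form x).toAddMonoidHom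
      map_zero' := by ext; simp
      map_add' := fun x y => by ext z; simp }
  have h : Continuous fun p : ω.PreLimit × ω.PreLimit => inner' p.1 p.2 :=
    MulOpposite.continuous_op.comp PreLimit.continuous_form
  exact (UniformSpace.Completion.isDenseInducing_toCompl ω.PreLimit).extend_Z_bilin
    (UniformSpace.Completion.isDenseInducing_toCompl ω.PreLimit) h

theorem induction {motive : ω.Limit → Prop} (x : ω.Limit)
    (hc : IsClosed {x | motive x}) (h : ∀ p, motive (ofPre ω p)) : motive x :=
  UniformSpace.Completion.induction_on x hc h

theorem cinner {X : Type*} [TopologicalSpace X] {f g : X → ω.Limit}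
    (hf : Continuous f) (hg : Continuous g) : Continuous fun x => inner Bᵐᵒᵖ (f x) (g x) :=
  continuous_inner.comp (hf.prodMk hg)

theorem norm_sq_eq (x : ω.Limit) : ‖x‖ ^ 2 = ‖inner Bᵐᵒᵖ x x‖ := by
  induction x using induction with
  | hc => exact isClosed_eq (by fun_prop) (cinner continuous_id continuous_id).norm
  | h p => rw [norm_ofPre, inner_ofPre, PreLimit.norm_sq, MulOpposite.norm_op]

instance : CStarModule Bᵐᵒᵖ ω.Limit where
  inner_add_right {x y z} := by
    induction x using induction with
    | hc =>
      exact isClosed_eq (cinner continuous_id continuous_const)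
        ((cinner continuous_id continuous_const).add (cinner continuous_id continuous_const))
    | h x =>
      induction y using induction with
      | hc =>
        exact isClosed_eq (cinner continuous_const (by fun_prop))
          ((cinner continuous_const continuous_id).add continuous_const)
      | h y =>
        induction z using induction with
        | hc =>
          exact isClosed_eq (cinner continuous_const (by fun_prop))
            (continuous_const.add (cinner continuous_const continuous_id))
        | h z =>
          rw [← map_add, inner_ofPre, inner_ofPre, inner_ofPre, map_add, MulOpposite.op_add]
  inner_self_nonneg {x} := by
    induction x using induction with
    | hc =>
      exact (isClosed_le continuous_const
        (MulOpposite.continuous_unop.comp (cinner continuous_id continuous_id)) :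
          IsClosed {x : ω.Limit | (0 : B) ≤ (inner Bᵐᵒᵖ x x).unop})
    | h p => rw [inner_ofPre]; exact PreLimit.form_self_nonneg p
  inner_self {x} := by
    rw [← norm_eq_zero, ← norm_sq_eq, sq_eq_zero_iff, norm_eq_zero]
  inner_op_smul_right {b x y} := by
    obtain ⟨b, rfl⟩ := MulOpposite.op_surjective b
    induction x using induction with
    | hc =>
      exact isClosed_eq (cinner continuous_id continuous_const)
        (continuous_const.mul (cinner continuous_id continuous_const))
    | h x =>
      induction y using induction with
      | hc =>
        exact isClosed_eq (cinner continuous_const (continuous_const_smul _))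
          (continuous_const.mul (cinner continuous_const continuous_id))
      | h y =>
        rw [op_smul_ofPre, inner_ofPre, inner_ofPre, PreLimit.form_op_smul_right,
          MulOpposite.op_mul]
  inner_smul_right_complex {c x y} := by
    induction x using induction with
    | hc =>
      exact isClosed_eq (cinner continuous_id continuous_const)
        ((cinner continuous_id continuous_const).const_smul c)
    | h x =>
      induction y using induction with
      | hc =>
        exact isClosed_eq (cinner continuous_const (continuous_const_smul _))
          ((cinner continuous_const continuous_id).const_smul c)
      | h y =>
        rw [← map_smul, inner_ofPre, inner_ofPre, map_smul, MulOpposite.op_smul]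
  star_inner x y := by
    induction x using induction with
    | hc =>
      exact isClosed_eq (cinner continuous_id continuous_const).star
        (cinner continuous_const continuous_id)
    | h x =>
      induction y using induction with
      | hc =>
        exact isClosed_eq (cinner continuous_const continuous_id).star
          (cinner continuous_id continuous_const)
      | h y =>
        rw [inner_ofPre, inner_ofPre, ← MulOpposite.op_star, PreLimit.star_form]
  norm_eq_sqrt_norm_inner_self x := by
    rw [← norm_sq_eq, Real.sqrt_sq (norm_nonneg _)]

theorem rinner_ofPre (p q : ω.PreLimit) :
    rinner B (ofPre ω p) (ofPre ω q) = PreLimit.form p q := by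
  rw [rinner]
  exact congrArg MulOpposite.unop (inner_ofPre p q)

/-- Extension of a bounded linear map from the algebraic inductive limit to its completion. -/
def extend {G : Type*} [NormedAddCommGroup G] [NormedSpace ℂ G] [CompleteSpace G]
    (f : ω.PreLimit →L[ℂ] G) : ω.Limit →L[ℂ] G :=
  (f.fromCompletion : UniformSpace.Completion ω.PreLimit →L[ℂ] G)

theorem extend_ofPre {G : Type*} [NormedAddCommGroup G] [NormedSpace ℂ G] [CompleteSpace G]
    (f : ω.PreLimit →L[ℂ] G) (p : ω.PreLimit) : extend f (ofPre ω p) = f p :=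
  ContinuousLinearMap.fromCompletion_apply_coe f p

/-- The left multiplication by `b` on the inductive limit. -/
def leftCLM (b : B) : ω.Limit →L[ℂ] ω.Limit :=
  extend ((ofPre ω).comp (PreLimit.leftCLM b))

theorem leftCLM_ofPre (b : B) (p : ω.PreLimit) :
    leftCLM b (ofPre ω p) = ofPre ω (PreLimit.left b p) :=
  extend_ofPre _ _

theorem rinner_leftCLM (b : B) (x y : ω.Limit) :
    rinner B (leftCLM b x) y = rinner B x (leftCLM (star b) y) := by
  induction x using induction with
  | hc =>
    exact isClosed_eq (rinner.continuous_comp (leftCLM b).continuous continuous_const)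
      (rinner.continuous_comp continuous_id continuous_const)
  | h p =>
    induction y using induction with
    | hc =>
      exact isClosed_eq (rinner.continuous_comp continuous_const continuous_id)
        (rinner.continuous_comp continuous_const (leftCLM (star b)).continuous)
    | h q => rw [leftCLM_ofPre, leftCLM_ofPre, rinner_ofPre, rinner_ofPre, PreLimit.form_left]

theorem hom_ext {G : Type*} [NormedAddCommGroup G] [NormedSpace ℂ G] {f g : ω.Limit →L[ℂ] G}
    (h : ∀ p, f (ofPre ω p) = g (ofPre ω p)) (x : ω.Limit) : f x = g x := by
  induction x using induction with
  | hc => exact isClosed_eq f.continuous g.continuous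
  | h p => exact h p

/-- The left multiplication by `b` as an adjointable operator. -/
def leftAdj (b : B) : Adj B ω.Limit := Adj.mk (leftCLM b) (leftCLM (star b)) (rinner_leftCLM b)

theorem leftAdj_apply (b : B) (x : ω.Limit) : leftAdj b x = leftCLM b x := rfl

theorem star_leftAdj (b : B) : star (leftAdj (ω := ω) b) = leftAdj (star b) :=
  Adj.star_eq_of _ _ fun x y => by
    rw [leftAdj_apply, leftAdj_apply]; exact rinner_leftCLM b x y

variable (ω) in
/-- The left action of `B` on the inductive limit. -/
def left : B →⋆ₐ[ℂ] Adj B ω.Limit where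
  toFun := leftAdj
  map_one' := Adj.ext' <| hom_ext (f := leftCLM 1) (g := .id ℂ _) fun p => by
    rw [leftCLM_ofPre]
    refine congrArg (ofPre ω) (PreLimit.ext fun t => ?_)
    rw [PreLimit.val_left, map_one, Adj.one_apply]
  map_mul' b c := Adj.ext' <| hom_ext (f := leftCLM (b * c)) (g := (leftCLM b).comp (leftCLM c))
    fun p => by
      rw [ContinuousLinearMap.comp_apply, leftCLM_ofPre, leftCLM_ofPre, leftCLM_ofPre]
      refine congrArg (ofPre ω) (PreLimit.ext fun t => ?_)
      rw [PreLimit.val_left, map_mul, Adj.mul_apply]; rfl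
  map_zero' := Adj.ext' <| hom_ext (f := leftCLM 0) (g := 0) fun p => by
    rw [leftCLM_ofPre, zero_apply, ← map_zero (ofPre ω)]
    refine congrArg (ofPre ω) (PreLimit.ext fun t => ?_)
    rw [PreLimit.val_left, map_zero, Adj.zero_apply]; rfl
  map_add' b c := Adj.ext' <| hom_ext (f := leftCLM (b + c)) (g := leftCLM b + leftCLM c)
    fun p => by
      rw [add_apply, leftCLM_ofPre, leftCLM_ofPre, leftCLM_ofPre, ← map_add]
      refine congrArg (ofPre ω) (PreLimit.ext fun t => ?_)
      rw [PreLimit.val_left, map_add, Adj.add_apply]; rfl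
  commutes' c := Adj.ext' <| hom_ext (f := leftCLM (algebraMap ℂ B c)) (g := c • .id ℂ _)
    fun p => by
      rw [smul_apply, leftCLM_ofPre, ContinuousLinearMap.id_apply, ← map_smul]
      refine congrArg (ofPre ω) (PreLimit.ext fun t => ?_)
      rw [PreLimit.val_left, AlgHomClass.commutes, Algebra.algebraMap_eq_smul_one, Adj.smul_apply,
        Adj.one_apply]; rfl
  map_star' b := (star_leftAdj b).symm

theorem left_ofPre (b : B) (p : ω.PreLimit) :
    left ω b (ofPre ω p) = ofPre ω (PreLimit.left b p) := leftCLM_ofPre b p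

theorem ofPre_eq {f g : ω.PreLimit} (h : ‖f - g‖ = 0) : ofPre ω f = ofPre ω g := by
  rw [← sub_eq_zero, ← map_sub, ← norm_eq_zero, norm_ofPre, h]

variable (ω s) in
/-- The canonical embedding of `E_s` into the inductive limit. -/
def incl : ϑ.Fiber s →L[ℂ] ω.Limit :=
  ((ofPre ω : ω.PreLimit →ₗ[ℂ] ω.Limit).comp (PreLimit.incl ω s)).mkContinuous 1 fun p => by
    change ‖ofPre ω (PreLimit.incl ω s p)‖ ≤ _
    rw [one_mul]
    refine le_of_sq_le_sq ?_ (norm_nonneg _)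
    rw [rinner.norm_sq B, rinner.norm_sq B, rinner_ofPre, PreLimit.form_incl]

theorem incl_apply (p : ϑ.Fiber s) : incl ω s p = ofPre ω (PreLimit.incl ω s p) := rfl

theorem rinner_incl (p q : ϑ.Fiber s) : rinner B (incl ω s p) (incl ω s q) = rinner B p q := by
  rw [incl_apply, incl_apply, rinner_ofPre, PreLimit.form_incl]

/-- Holds already at all late times, because left multiplication by `b` commutes with right
multiplication by `ω_r`. -/
theorem left_incl (b : B) (p : ϑ.Fiber s) :
    left ω b (incl ω s p) = incl ω s (ϑ.leftAction s b p) := by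
  rw [incl_apply, left_ofPre, incl_apply]
  refine ofPre_eq (PreLimit.norm_sub_eq_zero ?_)
  filter_upwards [PreLimit.eventually_incl (ω := ω) s] with t ⟨r, hr, h1, h2⟩
  rw [PreLimit.val_left, h2, h2, mulTo_leftAction]

/-- Compatibility of the embeddings with the inductive system: at a late time both vectors equal `p
ω_{r+d}`, by associativity and `ω_r ω_d = ω_{r+d}`. -/
theorem incl_mulTo_vec (h : s + r = t) (hr : 0 < r) (p : ϑ.Fiber s) :
    incl ω t (ϑ.mulTo h p (ω.vec r hr)) = incl ω s p := by
  refine ofPre_eq (PreLimit.norm_sub_eq_zero ?_)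
  filter_upwards [PreLimit.eventually_incl (ω := ω) t] with u ⟨d, hd, h1, h2⟩
  rw [h2, PreLimit.val_incl p (add_pos hr hd) (by rw [← add_assoc, h, h1]),
    ϑ.mulTo_assoc h h1 rfl, ω.mulTo_vec_vec rfl hr hd]

/-- Every closed subspace that contains the images of all `E_s` is everything. -/
theorem mem_of_incl {M : Submodule ℂ ω.Limit} (hM : IsClosed (M : Set ω.Limit))
    (h : ∀ s : T, 0 < s → ∀ p, incl ω s p ∈ M) (x : ω.Limit) : x ∈ M := by
  induction x using induction with
  | hc => exact hM
  | h f =>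
    obtain ⟨s, hs, hf⟩ := PreLimit.exists_norm_sub_incl_eq_zero f
    rw [ofPre_eq hf]
    exact h s hs _

end Limit

end CentralUnitalUnit

end E0Semigroup

end

/-! ### The admissible time sets and the unitary semigroup on `E ⊙ E_-` -/

noncomputable section

theorem AddSubmonoid.isTimeSet_of_eq {T : AddSubmonoid ℝ}
    (hT : (T : Set ℝ) = Set.Ici 0 ∨ (T : Set ℝ) = Set.range ((↑) : ℕ → ℝ)) : T.IsTimeSet := by
  have hmem (x : ℝ) : x ∈ T ↔ x ∈ (T : Set ℝ) := Iff.rfl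
  refine ⟨fun s t hst => ?_, ?_⟩
  · have hst' : (s : ℝ) < t := hst
    have hmem' : (t : ℝ) - s ∈ T := by
      rcases hT with hT | hT
      · rw [hmem, hT]; exact sub_nonneg.2 hst'.le
      · obtain ⟨m, hm⟩ : (s : ℝ) ∈ Set.range ((↑) : ℕ → ℝ) := hT ▸ s.2
        obtain ⟨n, hn⟩ : (t : ℝ) ∈ Set.range ((↑) : ℕ → ℝ) := hT ▸ t.2
        rw [← hm, ← hn] at hst' ⊢
        rw [hmem, hT]
        exact ⟨n - m, Nat.cast_sub (Nat.cast_lt.1 hst').le⟩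
    exact ⟨⟨_, hmem'⟩, sub_pos.2 hst', Subtype.ext (add_sub_cancel _ _)⟩
  · have h1 : (1 : ℝ) ∈ T := by
      rcases hT with hT | hT
      · rw [hmem, hT]; exact Set.mem_Ici.2 zero_le_one
      · rw [hmem, hT]; exact ⟨1, Nat.cast_one⟩
    exact ⟨⟨1, h1⟩, (one_pos : (0 : ℝ) < 1)⟩

namespace E0Semigroup.CentralUnitalUnit

open InternalTensor

variable {T : AddSubmonoid ℝ} [T.IsTimeSet]
variable {B : Type*} [CStarAlgebra B] [PartialOrder B] [StarOrderedRing B]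
variable {E : Type*} [NormedAddCommGroup E] [NormedSpace ℂ E] [CompleteSpace E]
  [Module Bᵐᵒᵖ E] [CStarModule Bᵐᵒᵖ E]
variable {ϑ : E0Semigroup T B E} (ω : ϑ.CentralUnitalUnit) {s t u r : T}

/-- The tensor product of `E` with the inductive limit of the product system. -/
abbrev Dilation : Type _ := InternalTensor E (Limit.left ω)

/-- For the image `Ω` of `ω_t` in the limit, with any `t > 0`, centrality and unitality give `⟨Ω, b
Ω⟩ = b`. So `x ↦ x ⊙ Ω` preserves inner products, and `a ⊙ id = 0` forces `⟨a x, a x⟩ = 0`. -/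
theorem amplify_injective : Function.Injective (amplify E (Limit.left ω)) := by
  rw [injective_iff_map_eq_zero]
  intro a ha
  obtain ⟨t, ht⟩ := AddSubmonoid.IsTimeSet.exists_pos (T := T)
  refine Adj.ext' fun x => ?_
  have h : tmul E (Limit.left ω) (a x) (Limit.incl ω t (ω.vec t ht)) = 0 := by
    rw [← amplify_tmul, ha, Adj.zero_apply]
  have h' := rinner_tmul (φ := Limit.left ω) (a x) (a x) (Limit.incl ω t (ω.vec t ht))
    (Limit.incl ω t (ω.vec t ht))
  rw [h, rinner.zero_right, Limit.left_incl, Limit.rinner_incl, ω.central, rinner.op_smul_right,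
    ω.unital, one_mul] at h'
  exact rinner.self_eq_zero.1 h'.symm

/-- Left multiplication by `p` respects the identifications of the limit: `p (q ω_t) = (p q) ω_t`.
This permits moving second factors to a common time. -/
theorem incl_mulTo_mulTo_vec {w v : T} (h : s + r = u) (h' : s + v = w) (hr : r + t = v)
    (ht : 0 < t) (p : ϑ.Fiber s) (q : ϑ.Fiber r) :
    Limit.incl ω w (ϑ.mulTo h' p (ϑ.mulTo hr q (ω.vec t ht))) =
      Limit.incl ω u (ϑ.mulTo h p q) := by
  rw [← ϑ.mulTo_assoc h (by rw [← h, add_assoc, hr, h']) hr h', Limit.incl_mulTo_vec]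

/-- Both sides equal `⟨q, ⟨p, ⟨x, x'⟩ p'⟩ q'⟩`. This is the isometry behind `x ⊙ p q ↦ x p ⊙ q`. -/
theorem rinner_tmul_incl_mulTo (h : t + r = u) (x x' : E) (p p' : ϑ.Fiber t) (q q' : ϑ.Fiber r) :
    rinner B (tmul E (Limit.left ω) x (Limit.incl ω u (ϑ.mulTo h p q)))
        (tmul E (Limit.left ω) x' (Limit.incl ω u (ϑ.mulTo h p' q'))) =
      rinner B (tmul E (Limit.left ω) (ϑ.act t x p) (Limit.incl ω r q))
        (tmul E (Limit.left ω) (ϑ.act t x' p') (Limit.incl ω r q')) := by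
  rw [rinner_tmul, rinner_tmul, Limit.left_incl, Limit.left_incl, Limit.rinner_incl,
    Limit.rinner_incl, rinner_act, ← mulTo_leftAction, rinner_mulTo]

/-- The surjectivity half of `E_t ⊙ E_- ≅ E_-`. A vector `p ∈ E_s` has the same image as `p ω_t`,
which lies in `E_{s+t} = E_{t+s}`; by strictness at `s`, products of `E_t` with `E_s`, now in this
order, are total there. -/
theorem mem_of_incl_mulTo (hstrict : ∀ t, IsStrict (ϑ.hom t)) (ht : 0 < t)
    {M : Submodule ℂ ω.Limit} (hM : IsClosed (M : Set ω.Limit))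
    (h : ∀ (r : T) (_ : 0 < r) (p : ϑ.Fiber t) (q : ϑ.Fiber r),
      Limit.incl ω (t + r) (ϑ.mulTo rfl p q) ∈ M) (y : ω.Limit) : y ∈ M := by
  refine Limit.mem_of_incl hM (fun s hs p => ?_) y
  rw [← Limit.incl_mulTo_vec (add_comm s t) ht]
  refine (Limit.incl ω (t + s)).mem_of_dense_span (ϑ.dense_span_mulTo rfl (hstrict s)) hM ?_ _
  rintro _ ⟨⟨p, q⟩, rfl⟩
  exact h s hs p q

theorem mem_of_tmul_incl_mulTo (hstrict : ∀ t, IsStrict (ϑ.hom t)) (ht : 0 < t)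
    {M : Submodule ℂ ω.Dilation} (hM : IsClosed (M : Set ω.Dilation))
    (h : ∀ (r : T) (_ : 0 < r) (x : E) (p : ϑ.Fiber t) (q : ϑ.Fiber r),
      tmul E (Limit.left ω) x (Limit.incl ω (t + r) (ϑ.mulTo rfl p q)) ∈ M)
    (y : ω.Dilation) : y ∈ M :=
  mem_of_tmul hM (fun x z => ω.mem_of_incl_mulTo hstrict ht
    (M := M.comap (tmulCLM (Limit.left ω) x : ω.Limit →ₗ[ℂ] ω.Dilation))
    (hM.preimage (tmulCLM (Limit.left ω) x).continuous) (fun r hr p q => h r hr x p q) z) y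

/-- The images of the `E_r` fill the second factor, and the vectors `x p` with `p ∈ E_t` fill the
first one by strictness at `t`. -/
theorem mem_of_tmul_act_incl (hstrict : ∀ t, IsStrict (ϑ.hom t))
    {M : Submodule ℂ ω.Dilation} (hM : IsClosed (M : Set ω.Dilation))
    (h : ∀ (r : T) (_ : 0 < r) (x : E) (p : ϑ.Fiber t) (q : ϑ.Fiber r),
      tmul E (Limit.left ω) (ϑ.act t x p) (Limit.incl ω r q) ∈ M)
    (y : ω.Dilation) : y ∈ M := by
  refine mem_of_tmul hM (fun x z => Limit.mem_of_incl
    (M := M.comap (tmulCLM (Limit.left ω) x : ω.Limit →ₗ[ℂ] ω.Dilation))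
    (hM.preimage (tmulCLM (Limit.left ω) x).continuous) (fun r hr q => ?_) z) y
  refine (tmulFlipCLM (Limit.left ω) (Limit.incl ω r q)).mem_of_dense_span
    (ϑ.dense_span_act (hstrict t)) hM ?_ x
  rintro _ ⟨⟨x, p⟩, rfl⟩
  exact h r hr x p q

theorem dilation_ext (hstrict : ∀ t, IsStrict (ϑ.hom t)) (ht : 0 < t) {a b : Adj B ω.Dilation}
    (h : ∀ (r : T) (_ : 0 < r) (x : E) (p : ϑ.Fiber t) (q : ϑ.Fiber r),
      a (tmul E (Limit.left ω) x (Limit.incl ω (t + r) (ϑ.mulTo rfl p q))) =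
        b (tmul E (Limit.left ω) x (Limit.incl ω (t + r) (ϑ.mulTo rfl p q)))) : a = b :=
  Adj.ext' <| ω.mem_of_tmul_incl_mulTo hstrict ht
    (M := LinearMap.eqLocus (a.toCLM : ω.Dilation →ₗ[ℂ] ω.Dilation)
      (b.toCLM : ω.Dilation →ₗ[ℂ] ω.Dilation))
    (isClosed_eq a.toCLM.continuous b.toCLM.continuous) h

/-- Existence of `w_t`. The factor `q` runs through the fibres at all positive times `r` and stands
for the vector `ξ` of `E_-`; source vectors and image vectors are total families with the same Gram
kernel. -/
theorem exists_unitary (hstrict : ∀ t, IsStrict (ϑ.hom t)) (ht : 0 < t) :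
    ∃ U : unitary (Adj B ω.Dilation), ∀ (r u : T) (_ : 0 < r) (h : t + r = u) (x : E)
      (p : ϑ.Fiber t) (q : ϑ.Fiber r),
      (U : Adj B ω.Dilation) (tmul E (Limit.left ω) x (Limit.incl ω u (ϑ.mulTo h p q))) =
        tmul E (Limit.left ω) (ϑ.act t x p) (Limit.incl ω r q) := by
  let ι := Σ r : {r : T // 0 < r}, E × ϑ.Fiber t × ϑ.Fiber r.1
  let f : ι → ω.Dilation := fun i =>
    tmul E (Limit.left ω) i.2.1 (Limit.incl ω (t + i.1) (ϑ.mulTo rfl i.2.2.1 i.2.2.2))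
  let g : ι → ω.Dilation := fun i =>
    tmul E (Limit.left ω) (ϑ.act t i.2.1 i.2.2.1) (Limit.incl ω i.1 i.2.2.2)
  have hf : Dense (Submodule.span ℂ (Set.range f) : Set ω.Dilation) := by
    rw [Submodule.dense_iff_topologicalClosure_eq_top, eq_top_iff]
    exact fun y _ => ω.mem_of_tmul_incl_mulTo hstrict ht
      (Submodule.isClosed_topologicalClosure _) (fun r hr x p q =>
        Submodule.le_topologicalClosure _ (Submodule.subset_span
          (Set.mem_range_self (⟨⟨r, hr⟩, x, p, q⟩ : ι)))) y
  have hg : Dense (Submodule.span ℂ (Set.range g) : Set ω.Dilation) := by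
    rw [Submodule.dense_iff_topologicalClosure_eq_top, eq_top_iff]
    exact fun y _ => ω.mem_of_tmul_act_incl (t := t) hstrict
      (Submodule.isClosed_topologicalClosure _) (fun r hr x p q =>
        Submodule.le_topologicalClosure _ (Submodule.subset_span
          (Set.mem_range_self (⟨⟨r, hr⟩, x, p, q⟩ : ι)))) y
  have hfg (i j) : rinner B (f i) (f j) = rinner B (g i) (g j) := by
    obtain ⟨⟨r, hr⟩, x, p, q⟩ := i
    obtain ⟨⟨r', hr'⟩, x', p', q'⟩ := j
    -- The two vectors may have second factors at different times `r` and `r'`. Replacing `q` by `q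
    -- ω_{r'}` and `q'` by `q' ω_r` brings both to time `r + r'` without changing any of the images
    -- in the limit.
    have h := ω.rinner_tmul_incl_mulTo rfl x x' p p' (ϑ.mulTo rfl q (ω.vec r' hr'))
      (ϑ.mulTo (add_comm r' r) q' (ω.vec r hr))
    rw [ω.incl_mulTo_mulTo_vec rfl, ω.incl_mulTo_mulTo_vec rfl, Limit.incl_mulTo_vec,
      Limit.incl_mulTo_vec] at h
    exact h
  obtain ⟨U, hU⟩ := exists_unitary_of_gram_eq hf hg hfg
  refine ⟨U, fun r u hr h x p q => ?_⟩
  subst h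
  exact hU ⟨⟨r, hr⟩, x, p, q⟩

open Classical in
/-- The unitary semigroup on `E ⊙ E_-`, determined by `w_t (x ⊙ p ξ) = x p ⊙ ξ` for `t > 0`. -/
def unitarySemigroup (hstrict : ∀ t, IsStrict (ϑ.hom t)) (t : T) : unitary (Adj B ω.Dilation) :=
  if ht : 0 < t then (ω.exists_unitary hstrict ht).choose else 1

theorem unitarySemigroup_of_not_pos (hstrict : ∀ t, IsStrict (ϑ.hom t)) (ht : ¬0 < t) :
    ω.unitarySemigroup hstrict t = 1 := dif_neg ht

theorem unitarySemigroup_apply (hstrict : ∀ t, IsStrict (ϑ.hom t)) (ht : 0 < t) (hr : 0 < r)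
    (h : t + r = u) (x : E) (p : ϑ.Fiber t) (q : ϑ.Fiber r) :
    (ω.unitarySemigroup hstrict t : Adj B ω.Dilation)
        (tmul E (Limit.left ω) x (Limit.incl ω u (ϑ.mulTo h p q))) =
      tmul E (Limit.left ω) (ϑ.act t x p) (Limit.incl ω r q) := by
  rw [unitarySemigroup, dif_pos ht]
  exact (ω.exists_unitary hstrict ht).choose_spec r u hr h x p q

/-- For `q ∈ E_t` and `p ∈ E_s`, `w_s w_t (x ⊙ q p ξ) = w_s (x q ⊙ p ξ) = x q p ⊙ ξ = w_{s+t} (x ⊙ q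
p ξ)`. The operator `w_t` acts first and removes the leftmost factor, so `E_{s+t}` is read as
`E_{t+s}`. -/
theorem unitarySemigroup_add (hstrict : ∀ t, IsStrict (ϑ.hom t)) (hs : 0 < s) (ht : 0 < t) :
    ω.unitarySemigroup hstrict (s + t) =
      ω.unitarySemigroup hstrict s * ω.unitarySemigroup hstrict t := by
  have hst := add_pos hs ht
  refine Subtype.ext (ω.dilation_ext hstrict hst fun r hr x m ξ => ?_)
  rw [Submonoid.coe_mul, Adj.mul_apply]
  -- A general `m ∈ E_{s+t}` need not be a product. As everything is linear and continuous in `m`,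
  -- it is enough to treat the products `q p`, which are total by strictness at `s`.
  obtain ⟨L, hL⟩ : ∃ L : ϑ.Fiber (s + t) →L[ℂ] ω.Dilation,
      ∀ m, L m = tmul E (Limit.left ω) x (Limit.incl ω _ (ϑ.mulTo rfl m ξ)) :=
    ⟨(tmulCLM (Limit.left ω) x).comp ((Limit.incl ω (s + t + r)).comp ((ϑ.mulTo rfl).flip ξ)),
      fun _ => rfl⟩
  have key : (ω.unitarySemigroup hstrict (s + t)).1.toCLM.comp L =
      (ω.unitarySemigroup hstrict s).1.toCLM.comp
        ((ω.unitarySemigroup hstrict t).1.toCLM.comp L) := by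
    refine ContinuousLinearMap.ext_on (ϑ.dense_span_mulTo (add_comm t s) (hstrict s)) ?_
    rintro _ ⟨⟨q, p⟩, rfl⟩
    rw [ContinuousLinearMap.comp_apply, ContinuousLinearMap.comp_apply,
      ContinuousLinearMap.comp_apply, Adj.toCLM_apply, Adj.toCLM_apply, Adj.toCLM_apply, hL,
      ω.unitarySemigroup_apply hstrict hst hr, act_mulTo,
      ϑ.mulTo_assoc (add_comm t s) rfl rfl (by rw [← add_assoc, add_comm t s]),
      ω.unitarySemigroup_apply hstrict ht (add_pos hs hr),
      ω.unitarySemigroup_apply hstrict hs hr]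
  have := congrArg (fun f => f m) key
  rwa [ContinuousLinearMap.comp_apply, ContinuousLinearMap.comp_apply,
    ContinuousLinearMap.comp_apply, Adj.toCLM_apply, Adj.toCLM_apply, Adj.toCLM_apply, hL] at this

/-- On `x ⊙ p ξ` this is `(a x) p = ϑ_t(a)(x p)`, tensored with `ξ`. -/
theorem unitarySemigroup_mul_amplify (hstrict : ∀ t, IsStrict (ϑ.hom t)) (ht : 0 < t)
    (a : Adj B E) :
    (ω.unitarySemigroup hstrict t : Adj B ω.Dilation) * amplify E (Limit.left ω) a =
      amplify E (Limit.left ω) (ϑ.hom t a) * ω.unitarySemigroup hstrict t := by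
  refine ω.dilation_ext hstrict ht fun r hr x p q => ?_
  rw [Adj.mul_apply, Adj.mul_apply, amplify_tmul, ω.unitarySemigroup_apply hstrict ht hr,
    ω.unitarySemigroup_apply hstrict ht hr, amplify_tmul, act_apply]

end E0Semigroup.CentralUnitalUnit

end

/-! ### Assembly of the theorem -/

theorem mainTheorem1 {B : Type u} [CStarAlgebra B] [PartialOrder B] [StarOrderedRing B]
    {E : Type v} [NormedAddCommGroup E] [NormedSpace ℂ E] [CompleteSpace E]
    [Module Bᵐᵒᵖ E] [CStarModule Bᵐᵒᵖ E]
    (T : AddSubmonoid ℝ)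
    (hT : (T : Set ℝ) = Set.Ici 0 ∨ (T : Set ℝ) = Set.range ((↑) : ℕ → ℝ))
    (ϑ : E0Semigroup T B E) (hstrict : ∀ t, IsStrict (ϑ.hom t)) (hspatial : ϑ.IsSpatial) :
    ∃ (E' : Correspondence.{u, v} B) (w : T → unitary (Adj B (InternalTensor E E'.left))),
      (w 0 = 1 ∧ ∀ s t, w (s + t) = w s * w t) ∧
      Function.Bijective (InternalTensor.amplify E E'.left).rangeRestrict ∧
      ∀ (t : T) (a : Adj B E),
        Unitary.conjStarAlgAut ℂ (Adj B (InternalTensor E E'.left)) (w t)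
            (InternalTensor.amplify E E'.left a) =
          InternalTensor.amplify E E'.left (ϑ.hom t a) := by
  have := AddSubmonoid.isTimeSet_of_eq hT
  obtain ⟨ω⟩ := hspatial
  -- `IsTimeSet` alone does not exclude negative times; both concrete time sets do. Time `0`, where
  -- `w` has the value `1`, is then the only case left besides the positive times.
  have hpos (t : T) : t = 0 ∨ 0 < t := by
    have h : (0 : ℝ) ≤ t := by
      rcases hT with hT | hT
      · exact (hT ▸ t.2 : (t : ℝ) ∈ Set.Ici (0 : ℝ))
      · obtain ⟨n, hn⟩ : (t : ℝ) ∈ Set.range ((↑) : ℕ → ℝ) := hT ▸ t.2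
        exact hn ▸ n.cast_nonneg
    exact (h.eq_or_lt).imp (fun h => Subtype.ext h.symm) id
  have h0 : ω.unitarySemigroup hstrict 0 = 1 :=
    ω.unitarySemigroup_of_not_pos hstrict (lt_irrefl _)
  refine ⟨{ carrier := ω.Limit, left := E0Semigroup.CentralUnitalUnit.Limit.left ω },
    ω.unitarySemigroup hstrict, ⟨h0, fun s t => ?_⟩, ⟨fun a b h => ?_, ?_⟩, fun t a => ?_⟩
  · rcases hpos s with rfl | hs
    · rw [h0, zero_add, one_mul]
    · rcases hpos t with rfl | ht
      · rw [h0, add_zero, mul_one]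
      · exact ω.unitarySemigroup_add hstrict hs ht
  · exact ω.amplify_injective (congrArg Subtype.val h)
  · rintro ⟨_, a, rfl⟩
    exact ⟨a, rfl⟩
  · rw [Unitary.conjStarAlgAut_apply]
    rcases hpos t with rfl | ht
    · rw [h0, ϑ.hom_zero]
      simp
    -- The intertwining relation turns `w_t (a ⊙ id) w_t*` into `(ϑ_t(a) ⊙ id) w_t w_t*`, and `w_t`
    -- is unitary.
    · rw [ω.unitarySemigroup_mul_amplify hstrict ht, mul_assoc]
      simp
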